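/- Let $z$ be the independent and $w=w(z)$ the dependent real variable. Consider the following second-order equations (the nonlinear second-order ODEs listed as similarity reductions of the Zabolotskaya–Khokhlov equation $u_{xt}-(uu_x)_x-u_{yy}=0$ by two-dimensional symmetry subalgebras), where $k_0,k_1,c_1,c_2,c_3$ are real parameters: 1. $-w^2+2(wz-1)w'-z^2w'^2-(4z+wz^2)w''=0$; 2. $-8wz^3K^2+2z^3k_1\lambda+\big(c_1^2+c_2^2w+8z^4K^2+3z^2(c_2^2k_1+2c_1K)\big)w'-c_2^2zw'^2+\big((-c_1^2-c_2^2w)z-4z^5K^2-2z^3(2c_1K+c_2^2k_1)\big)w''=0$, where $K=k_0-c_3k_1$ (the reduction gives $\lambda=4c_1k_0+c_2^2k_1-4c_1c_3k_1$; below $\lambda$ may be any real number); 3. $k_0w'+w'^2+(w-zk_0)w''=0$; 4. for $k_0\ne-\tfrac16,-\tfrac23$, $r=\frac{6k_0-2}{6k_0+1}$, $s=\frac{6k_0+1}{3k_0+2}$, $z>0$: $-r(2r-1)w^2z^r(1+6k_0)^2+\big(-s(1+s)z^3(2+3k_0)^2-4rwz^{r+1}(1+6k_0)^2\big)w'-z^{r+2}(1+6k_0)^2w'^2+\big(-s^2z^4(2+3k_0)^2-wz^{r+2}(1+6k_0)^2\big)w''=0$;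 5. $-2w^2+(3wz-6c_1^2z^2)w'-z^2w'^2+(-wz^2-4c_1^2z^3)w''=0$; 6. $-6c_2^2w^2-(z+8c_2^2wz)w'-c_2^2z^2w'^2-(z^2+c_2^2wz^2)w''=0$; 7. for $k_0\ne1,-\tfrac13$, $r=\frac{2(3k_0-1)}{3(1-k_0)}$, $s=\frac{3(k_0-1)}{1+3k_0}$, $z>0$: $\big((-1-s)wz^{1+r}+3(1+r)(k_0-1)\big)w'-sz^{2+r}w'^2+\big(-swz^{2+r}+3z(k_0-1)\big)w''=0$; and 7′. the same equation with $s$ replaced by $-s$ (this is the form that corresponds to the similarity variable $z=(3(1-k_0)t+2c_3)x^{s}$); 8. $(4+2c_3wz)w'+c_3z^2w'^2+z(2+c_3wz)w''=0$ (in the reduction $c_3\neq0$); 9. $2w'+w'^2+ww''=0$. Each is considered on its domain, the set of $(z,w)$ (with $z>0$ in 4, 7, 7′) where the coefficient of $w''$ is nonzero. An equation is called linearizable near a point $p$ of its domain if there is a $C^\infty$ diffeomorphism $(Q,r)\mapsto(z,w)=(f(Q,r),g(Q,r))$ from an open set onto an open neighbourhood of $p$ in the domain which transforms the equation into a linear equation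 $Q''+a(r)Q'+b(r)Q+c(r)=0$ with $C^\infty$ coefficients. For an equation $\Delta:\ w''+A(z,w)w'^3+B(z,w)w'^2+C(z,w)w'+D(z,w)=0$ put $$\Psi_1=3A_{zz}-2B_{zw}+C_{ww}-3(CA)_z+3(DA)_w+(B^2)_z+3AD_w-BC_w,$$ $$\Psi_2=3D_{ww}-2C_{zw}+B_{zz}-3(DA)_z+3(DB)_w-(C^2)_w-3DA_z+CB_z.$$ **Claim.** On its domain each of these equations is equivalent to one of the form $\Delta$ with $A,B,C,D$ smooth. For each equation let $P$ be the following condition on its parameters: never for 1, 4, 7, 9; $c_2=0$ or $k_0=k_1=0$ for 2; $k_0=0$ for 3; $c_1=0$ for 5; $c_2=0$ for 6; $k_0=\tfrac19$ for 7′; $c_3=0$ for 8. Then (i) for every nonempty open subset $V$ of the domain, $\Psi_1=\Psi_2=0$ identically on $V$ if and only if $P$ holds; (ii) for every point $p$ of the domain, the equation is linearizable near $p$ if and only if $P$ holds. In particular 8 is never linearizable for the admissible values $c_3\ne0$. Moreover: for 1, $\Psi_1=\dfrac{54z}{(4+wz)^3}$ and $\Psi_2=-\dfrac{72(-2+wz)}{z(4+wz)^3}$.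 For 3 with $k_0=0$, a $C^2$ function $w$ satisfies the equation at a point if and only if $(w^2)''=0$ there. For 4, $\Psi_1$ vanishes identically on a nonempty open subset of the domain if and only if $k_0=\tfrac19$, and then $\Psi_2=\dfrac{18z^{4/5}}{25(w+z^{14/5})^2}$. For 7, on any nonempty open subset of the domain $\Psi_1$ vanishes identically if and only if $k_0=-\tfrac1{15}$, and $\Psi_2$ vanishes identically if and only if $k_0=\tfrac1{21}$. -/

import Mathlib

open scoped ContDiff

/-- A second order ordinary differential equation `lhs z w w' w'' = 0` for `w = w(z)`, considered
over a set `dom` of points `(z, w)`. -/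
structure SecondOrderODE where
  /-- the points `(z, w)` over which the equation is considered -/
  dom : Set (ℝ × ℝ)
  /-- the left-hand side, as a function of `z`, `w`, `w'`, `w''` -/
  lhs : ℝ → ℝ → ℝ → ℝ → ℝ

/-- The coefficients of `w'' + A(z,w) w'^3 + B(z,w) w'^2 + C(z,w) w' + D(z,w) = 0`. -/
structure CubicForm where
  A : ℝ → ℝ → ℝ
  B : ℝ → ℝ → ℝ
  C : ℝ → ℝ → ℝ
  D : ℝ → ℝ → ℝ

/-- Partial derivative with respect to `z`. -/
noncomputable def pz (f : ℝ → ℝ → ℝ) (z w : ℝ) : ℝ := deriv (fun t => f t w) z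

/-- Partial derivative with respect to `w`. -/
noncomputable def pw (f : ℝ → ℝ → ℝ) (z w : ℝ) : ℝ := deriv (fun t => f z t) w

/-- Lie's first invariant. -/
noncomputable def CubicForm.Psi₁ (N : CubicForm) (z w : ℝ) : ℝ :=
  3 * pz (pz N.A) z w - 2 * pw (pz N.B) z w + pw (pw N.C) z w
    - 3 * pz (fun z w => N.C z w * N.A z w) z w + 3 * pw (fun z w => N.D z w * N.A z w) z w
    + pz (fun z w => N.B z w ^ 2) z w + 3 * N.A z w * pw N.D z w - N.B z w * pw N.C z w

/-- Lie's second invariant. -/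
noncomputable def CubicForm.Psi₂ (N : CubicForm) (z w : ℝ) : ℝ :=
  3 * pw (pw N.D) z w - 2 * pw (pz N.C) z w + pz (pz N.B) z w
    - 3 * pz (fun z w => N.D z w * N.A z w) z w + 3 * pw (fun z w => N.D z w * N.B z w) z w
    - pw (fun z w => N.C z w ^ 2) z w - 3 * N.D z w * pz N.A z w + N.C z w * pz N.B z w

namespace SecondOrderODE

/-- Over its domain the equation is equivalent to `w'' + A w'^3 + B w'^2 + C w' + D = 0`, with
coefficients that are smooth functions of `(z, w)` there (and so are uniquely determined there). -/
def HasCubicForm (E : SecondOrderODE) (N : CubicForm) : Prop :=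
  ContDiffOn ℝ ∞ (fun x : ℝ × ℝ => N.A x.1 x.2) E.dom ∧
  ContDiffOn ℝ ∞ (fun x : ℝ × ℝ => N.B x.1 x.2) E.dom ∧
  ContDiffOn ℝ ∞ (fun x : ℝ × ℝ => N.C x.1 x.2) E.dom ∧
  ContDiffOn ℝ ∞ (fun x : ℝ × ℝ => N.D x.1 x.2) E.dom ∧
  ∀ z w, (z, w) ∈ E.dom → ∀ w₁ w₂ : ℝ, E.lhs z w w₁ w₂ = 0 ↔
    w₂ + N.A z w * w₁ ^ 3 + N.B z w * w₁ ^ 2 + N.C z w * w₁ + N.D z w = 0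

/-- The equation is linearizable near the point `p` of the `(z, w)`-plane: some smooth invertible
point transformation `T : (Q, r) ↦ (z, w) = (f(Q, r), g(Q, r))` onto an open neighbourhood of `p`
turns it into a linear equation `Q'' + a(r) Q' + b(r) Q + c(r) = 0` for `Q = Q(r)`.
For a function `Q` of `r`, the derivatives of `w` with respect to `z` along the transformed curve
`z = f(Q(r), r)`, `w = g(Q(r), r)` are computed by the chain rule wherever `dz/dr ≠ 0`. -/
def LinearizableAt (E : SecondOrderODE) (p : ℝ × ℝ) : Prop :=
  ∃ (T : OpenPartialHomeomorph (ℝ × ℝ) (ℝ × ℝ)) (a b c : ℝ → ℝ),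
    p ∈ T.target ∧ T.target ⊆ E.dom ∧
    ContDiffOn ℝ ∞ T T.source ∧ ContDiffOn ℝ ∞ T.symm T.target ∧
    (∀ x ∈ T.source, ContDiffAt ℝ ∞ a x.2 ∧ ContDiffAt ℝ ∞ b x.2 ∧ ContDiffAt ℝ ∞ c x.2) ∧
    ∀ (Q : ℝ → ℝ) (r : ℝ), (Q r, r) ∈ T.source → ContDiffAt ℝ 2 Q r →
      let z : ℝ → ℝ := fun t => (T (Q t, t)).1
      let w : ℝ → ℝ := fun t => (T (Q t, t)).2
      let w₁ : ℝ → ℝ := fun t => deriv w t / deriv z t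
      let w₂ : ℝ → ℝ := fun t => deriv w₁ t / deriv z t
      deriv z r ≠ 0 →
        (E.lhs (z r) (w r) (w₁ r) (w₂ r) = 0 ↔
          deriv (deriv Q) r + a r * deriv Q r + b r * Q r + c r = 0)

/-- The equation has the cubic form; Lie's two invariants both vanish identically on a nonempty
open part of the domain exactly when `P` holds; and the equation is linearizable near a point of the
domain exactly when `P` holds. -/
def LinearizableIff (E : SecondOrderODE) (P : Prop) : Prop :=
  (∃ N : CubicForm, E.HasCubicForm N ∧
    ∀ V : Set (ℝ × ℝ), IsOpen V → V.Nonempty → V ⊆ E.dom →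
      ((∀ z w, (z, w) ∈ V → N.Psi₁ z w = 0 ∧ N.Psi₂ z w = 0) ↔ P)) ∧
  ∀ p ∈ E.dom, E.LinearizableAt p ↔ P

end SecondOrderODE

/-! The nonlinear second order reduced equations. The domain of each is the set where the
coefficient of `w''` does not vanish, with `z > 0` where real powers of `z` occur. -/

/-- Reduction by `{v₀, k₀ v₀ + z(1)}`. -/
def red21 : SecondOrderODE where
  dom := {x | 4 * x.1 + x.2 * x.1 ^ 2 ≠ 0}
  lhs z w w₁ w₂ := -w ^ 2 + 2 * (w * z - 1) * w₁ - z ^ 2 * w₁ ^ 2 - (4 * z + w * z ^ 2) * w₂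

/-- Reduction by `{k₁ v₀ + z(1), k₀ v₀ + x(c₁ e^{2 k₁ t}) + y(c₂ e^{k₁ t}) + z(c₃)}`. The reduction
gives `l = 4 c₁ k₀ + c₂² k₁ - 4 c₁ c₃ k₁`. -/
def red22 (l k₀ k₁ c₁ c₂ c₃ : ℝ) : SecondOrderODE where
  dom := {x | (-c₁ ^ 2 - c₂ ^ 2 * x.2) * x.1 - 4 * x.1 ^ 5 * (k₀ - c₃ * k₁) ^ 2
    - 2 * x.1 ^ 3 * (2 * c₁ * k₀ + c₂ ^ 2 * k₁ - 2 * c₁ * c₃ * k₁) ≠ 0}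
  lhs z w w₁ w₂ := -8 * w * z ^ 3 * (k₀ - c₃ * k₁) ^ 2 + 2 * z ^ 3 * k₁ * l
    + (c₁ ^ 2 + c₂ ^ 2 * w + 8 * z ^ 4 * (k₀ - c₃ * k₁) ^ 2
        + 3 * z ^ 2 * (c₂ ^ 2 * k₁ + 2 * c₁ * (k₀ - c₃ * k₁))) * w₁
    - c₂ ^ 2 * z * w₁ ^ 2
    + ((-c₁ ^ 2 - c₂ ^ 2 * w) * z - 4 * z ^ 5 * (k₀ - c₃ * k₁) ^ 2
        - 2 * z ^ 3 * (2 * c₁ * k₀ + c₂ ^ 2 * k₁ - 2 * c₁ * c₃ * k₁)) * w₂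

/-- Reduction by `{y(1), k₀ v₀ + y(c₂) + z(-(3/2)(k₀ t + c₃))}`. -/
def red27 (k₀ : ℝ) : SecondOrderODE where
  dom := {x | x.2 - x.1 * k₀ ≠ 0}
  lhs z w w₁ w₂ := k₀ * w₁ + w₁ ^ 2 + (w - z * k₀) * w₂

/-- The exponent `r` in the reduction by `{z(1), k₀ v₀ + x(c₁) + y(c₂) + z(t + c₃)}`. -/
noncomputable def r28 (k₀ : ℝ) : ℝ := (6 * k₀ - 2) / (6 * k₀ + 1)

/-- The exponent `s` in the reduction by `{z(1), k₀ v₀ + x(c₁) + y(c₂) + z(t + c₃)}`. -/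
noncomputable def s28 (k₀ : ℝ) : ℝ := (6 * k₀ + 1) / (3 * k₀ + 2)

/-- Reduction by `{z(1), k₀ v₀ + x(c₁) + y(c₂) + z(t + c₃)}`, for `k₀ ≠ -1/6, -2/3`. -/
noncomputable def red28a (k₀ : ℝ) : SecondOrderODE where
  dom := {x | 0 < x.1 ∧ -s28 k₀ ^ 2 * x.1 ^ 4 * (2 + 3 * k₀) ^ 2
    - x.2 * x.1 ^ (r28 k₀ + 2) * (1 + 6 * k₀) ^ 2 ≠ 0}
  lhs z w w₁ w₂ :=
    -r28 k₀ * (-1 + 2 * r28 k₀) * w ^ 2 * z ^ r28 k₀ * (1 + 6 * k₀) ^ 2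
    + (-s28 k₀ * (1 + s28 k₀) * z ^ 3 * (2 + 3 * k₀) ^ 2
        - 4 * r28 k₀ * w * z ^ (r28 k₀ + 1) * (1 + 6 * k₀) ^ 2) * w₁
    - z ^ (r28 k₀ + 2) * (1 + 6 * k₀) ^ 2 * w₁ ^ 2
    + (-s28 k₀ ^ 2 * z ^ 4 * (2 + 3 * k₀) ^ 2
        - w * z ^ (r28 k₀ + 2) * (1 + 6 * k₀) ^ 2) * w₂

/-- The same reduction for `k₀ = -1/6`. -/
def red28b1 (c₁ : ℝ) : SecondOrderODE where
  dom := {x | -x.2 * x.1 ^ 2 - 4 * c₁ ^ 2 * x.1 ^ 3 ≠ 0}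
  lhs z w w₁ w₂ := -2 * w ^ 2 + (3 * w * z - 6 * c₁ ^ 2 * z ^ 2) * w₁ - z ^ 2 * w₁ ^ 2
    + (-w * z ^ 2 - 4 * c₁ ^ 2 * z ^ 3) * w₂

/-- The same reduction for `k₀ = -2/3`. -/
def red28b2 (c₂ : ℝ) : SecondOrderODE where
  dom := {x | x.1 ^ 2 + c₂ ^ 2 * x.2 * x.1 ^ 2 ≠ 0}
  lhs z w w₁ w₂ := -6 * c₂ ^ 2 * w ^ 2 - (z + 8 * c₂ ^ 2 * w * z) * w₁ - c₂ ^ 2 * z ^ 2 * w₁ ^ 2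
    - (z ^ 2 + c₂ ^ 2 * w * z ^ 2) * w₂

/-- The exponent `r` in the reduction by `{y(1), k₀ v₀ + y(c₂) + z((3/2)(1 - k₀) t + c₃)}`. -/
noncomputable def r212 (k₀ : ℝ) : ℝ := 2 * (3 * k₀ - 1) / (3 * (1 - k₀))

/-- The constant `s` in the reduction by `{y(1), k₀ v₀ + y(c₂) + z((3/2)(1 - k₀) t + c₃)}`. -/
noncomputable def s212 (k₀ : ℝ) : ℝ := 3 * (k₀ - 1) / (1 + 3 * k₀)

/-- Reduction by `{y(1), k₀ v₀ + y(c₂) + z((3/2)(1 - k₀) t + c₃)}`, for `k₀ ≠ 1, -1/3`, with the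
constant `s` kept as a parameter. It is considered for `s = s212 k₀` and for `s = -s212 k₀`; the
latter corresponds to the similarity variable `z = (3 (1 - k₀) t + 2 c₃) x ^ (s212 k₀)`. -/
noncomputable def red212a (s k₀ : ℝ) : SecondOrderODE where
  dom := {x | 0 < x.1 ∧ -s * x.2 * x.1 ^ (2 + r212 k₀) + 3 * x.1 * (k₀ - 1) ≠ 0}
  lhs z w w₁ w₂ :=
    ((-1 - s) * w * z ^ (1 + r212 k₀) + 3 * (1 + r212 k₀) * (k₀ - 1)) * w₁
    - s * z ^ (2 + r212 k₀) * w₁ ^ 2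
    + (-s * w * z ^ (2 + r212 k₀) + 3 * z * (k₀ - 1)) * w₂

/-- The same reduction for `k₀ = 1` (where `c₃ ≠ 0`). -/
def red212b1 (c₃ : ℝ) : SecondOrderODE where
  dom := {x | x.1 * (2 + c₃ * x.2 * x.1) ≠ 0}
  lhs z w w₁ w₂ := (4 + 2 * c₃ * w * z) * w₁ + c₃ * z ^ 2 * w₁ ^ 2 + z * (2 + c₃ * w * z) * w₂

/-- The same reduction for `k₀ = -1/3`. -/
def red212b2 : SecondOrderODE where
  dom := {x | x.2 ≠ 0}
  lhs _ w w₁ w₂ := 2 * w₁ + w₁ ^ 2 + w * w₂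

/-! The solutions of `w'' + A w'^3 + B w'^2 + C w' + D = 0` are the unparametrized geodesics of
every torsion-free connection with `Γ¹₁₁ = 2Y - C`, `Γ²₁₁ = D`, `Γ¹₁₂ = X`, `Γ²₁₂ = Y`, `Γ¹₂₂ = -A`,
`Γ²₂₂ = B + 2X`, where `X`, `Y` are arbitrary. Lie's invariants are the Cotton tensor of this
projective class, so they can be evaluated with any convenient `X`, `Y`.

If the equation is the pullback of `Q'' + a Q' + b Q + c = 0` by `Q = u(z, w)`, `r = v(z, w)`,
choose `X`, `Y` so that `∇dv = 0` and `∇du = -a(v) du dv - (b(v) u + c(v)) dv²`. The curvature is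
then given by `K = k(v) dv²` with `k = b - a'/2 - a²/4`. As `dv` is parallel, `∇K = k'(v) dv³` is
totally symmetric, and the invariants vanish (`CubicForm.psi_eq_zero_of_isPullbackAt`). A
linearizing diffeomorphism makes the equation such a pullback, because enough solutions pass through
each point to compare the coefficients of the cubic in `w'`; this gives necessity
(`LinearizableAt.psi_eq_zero`). Conversely, a pullback with nonzero Jacobian is linearizable by the
inverse function theorem (`linearizableAt_of_isPullbackAt`).

The general sufficiency theorem of Lie is not needed. After division by a function of `z`, each
equation is either linear in `w` or of the form `W w'' + w'^2 + (γ₁ W + γ₀) w' + δ₂ W² + δ₁ W + δ₀ =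
0` with `W = w + φ(z)`. For the latter both invariants vanish exactly when `γ₀ = 2φ'` and `δ₁ = φ''
+ γ₁ φ'` (`QuadraticForm.psi`), and then `Q = W²` satisfies a linear equation
(`QuadraticForm.linearizableAt`). What remains is to solve these two conditions for the parameters
of each equation. -/

open scoped Topology
open Filter

/-! ### Calculus of smooth functions of two variables. -/

/-- A real function of two variables is smooth on `U`. -/
def SmoothOn₂ (U : Set (ℝ × ℝ)) (f : ℝ → ℝ → ℝ) : Prop :=
  ContDiffOn ℝ ∞ (fun x : ℝ × ℝ => f x.1 x.2) U

namespace SmoothOn₂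

variable {U V : Set (ℝ × ℝ)} {f g : ℝ → ℝ → ℝ} {z w : ℝ}

theorem mono (hf : SmoothOn₂ U f) (h : V ⊆ U) : SmoothOn₂ V f := ContDiffOn.mono hf h

theorem add (hf : SmoothOn₂ U f) (hg : SmoothOn₂ U g) :
    SmoothOn₂ U (fun z w => f z w + g z w) := ContDiffOn.add hf hg

theorem sub (hf : SmoothOn₂ U f) (hg : SmoothOn₂ U g) :
    SmoothOn₂ U (fun z w => f z w - g z w) := ContDiffOn.sub hf hg

theorem mul (hf : SmoothOn₂ U f) (hg : SmoothOn₂ U g) :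
    SmoothOn₂ U (fun z w => f z w * g z w) := ContDiffOn.mul hf hg

theorem pow (hf : SmoothOn₂ U f) (n : ℕ) : SmoothOn₂ U (fun z w => f z w ^ n) :=
  ContDiffOn.pow hf n

theorem const (c : ℝ) : SmoothOn₂ U (fun _ _ => c) := contDiffOn_const

theorem snd : SmoothOn₂ U (fun _ w => w) := contDiffOn_snd

theorem fst : SmoothOn₂ U (fun z _ => z) := contDiffOn_fst

theorem div (hf : SmoothOn₂ U f) (hg : SmoothOn₂ U g) (h : ∀ z w, (z, w) ∈ U → g z w ≠ 0) :
    SmoothOn₂ U (fun z w => f z w / g z w) := ContDiffOn.div hf hg fun x hx => h x.1 x.2 hx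

theorem comp (hU : IsOpen U) {a : ℝ → ℝ} (hf : SmoothOn₂ U f)
    (ha : ∀ z w, (z, w) ∈ U → ContDiffAt ℝ ∞ a (f z w)) :
    SmoothOn₂ U (fun z w => a (f z w)) := fun x hx =>
  ((ha x.1 x.2 hx).comp x (ContDiffOn.contDiffAt hf (hU.mem_nhds hx))).contDiffWithinAt

theorem contDiffAt (hU : IsOpen U) (hf : SmoothOn₂ U f) (h : (z, w) ∈ U) :
    ContDiffAt ℝ ∞ (fun x : ℝ × ℝ => f x.1 x.2) (z, w) :=
  ContDiffOn.contDiffAt hf (hU.mem_nhds h)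

theorem hasFDerivAt (hU : IsOpen U) (hf : SmoothOn₂ U f) (h : (z, w) ∈ U) :
    HasFDerivAt (fun x : ℝ × ℝ => f x.1 x.2)
      (fderiv ℝ (fun x : ℝ × ℝ => f x.1 x.2) (z, w)) (z, w) :=
  ((hf.contDiffAt hU h).differentiableAt (by simp)).hasFDerivAt

theorem hasDerivAt_fst (hU : IsOpen U) (hf : SmoothOn₂ U f) (h : (z, w) ∈ U) :
    HasDerivAt (fun t => f t w) (fderiv ℝ (fun x : ℝ × ℝ => f x.1 x.2) (z, w) (1, 0)) z :=
  (hf.hasFDerivAt hU h).comp_hasDerivAt (f := fun t => (t, w)) z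
    ((hasDerivAt_id z).prodMk (hasDerivAt_const z w))

theorem hasDerivAt_snd (hU : IsOpen U) (hf : SmoothOn₂ U f) (h : (z, w) ∈ U) :
    HasDerivAt (fun t => f z t) (fderiv ℝ (fun x : ℝ × ℝ => f x.1 x.2) (z, w) (0, 1)) w :=
  (hf.hasFDerivAt hU h).comp_hasDerivAt (f := fun t => (z, t)) w
    ((hasDerivAt_const w z).prodMk (hasDerivAt_id w))

theorem pz_eq_fderiv (hU : IsOpen U) (hf : SmoothOn₂ U f) (h : (z, w) ∈ U) :
    pz f z w = fderiv ℝ (fun x : ℝ × ℝ => f x.1 x.2) (z, w) (1, 0) :=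
  (hf.hasDerivAt_fst hU h).deriv

theorem pw_eq_fderiv (hU : IsOpen U) (hf : SmoothOn₂ U f) (h : (z, w) ∈ U) :
    pw f z w = fderiv ℝ (fun x : ℝ × ℝ => f x.1 x.2) (z, w) (0, 1) :=
  (hf.hasDerivAt_snd hU h).deriv

theorem hasDerivAt_pz (hU : IsOpen U) (hf : SmoothOn₂ U f) (h : (z, w) ∈ U) :
    HasDerivAt (fun t => f t w) (pz f z w) z := by
  rw [hf.pz_eq_fderiv hU h]; exact hf.hasDerivAt_fst hU h

theorem hasDerivAt_pw (hU : IsOpen U) (hf : SmoothOn₂ U f) (h : (z, w) ∈ U) :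
    HasDerivAt (fun t => f z t) (pw f z w) w := by
  rw [hf.pw_eq_fderiv hU h]; exact hf.hasDerivAt_snd hU h

/-- The chain rule along a curve. -/
theorem hasDerivAt_comp (hU : IsOpen U) (hf : SmoothOn₂ U f) {x y : ℝ → ℝ} {x' y' t : ℝ}
    (h : (x t, y t) ∈ U) (hx : HasDerivAt x x' t) (hy : HasDerivAt y y' t) :
    HasDerivAt (fun t => f (x t) (y t)) (pz f (x t) (y t) * x' + pw f (x t) (y t) * y') t := by
  have := (hf.hasFDerivAt hU h).comp_hasDerivAt t (hx.prodMk hy)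
  refine this.congr_deriv ?_
  rw [hf.pz_eq_fderiv hU h, hf.pw_eq_fderiv hU h,
    show ((x', y') : ℝ × ℝ) = x' • (1, 0) + y' • (0, 1) by simp, map_add, map_smul, map_smul]
  simp [mul_comm]

theorem partial_fst (hU : IsOpen U) (hf : SmoothOn₂ U f) : SmoothOn₂ U (pz f) := by
  have h1 : ContDiffOn ℝ ∞ (fderiv ℝ (fun x : ℝ × ℝ => f x.1 x.2)) U :=
    ContDiffOn.fderiv_of_isOpen hf hU (by simp)
  exact (h1.clm_apply (contDiffOn_const (c := ((1, 0) : ℝ × ℝ)))).congr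
    fun x hx => hf.pz_eq_fderiv hU hx

theorem partial_snd (hU : IsOpen U) (hf : SmoothOn₂ U f) : SmoothOn₂ U (pw f) := by
  have h1 : ContDiffOn ℝ ∞ (fderiv ℝ (fun x : ℝ × ℝ => f x.1 x.2)) U :=
    ContDiffOn.fderiv_of_isOpen hf hU (by simp)
  exact (h1.clm_apply (contDiffOn_const (c := ((0, 1) : ℝ × ℝ)))).congr
    fun x hx => hf.pw_eq_fderiv hU hx

end SmoothOn₂

section
variable {U : Set (ℝ × ℝ)} {f g : ℝ → ℝ → ℝ} {z w : ℝ}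

theorem eventually_mem_fst (hU : IsOpen U) (h : (z, w) ∈ U) : ∀ᶠ t in 𝓝 z, (t, w) ∈ U :=
  (Continuous.prodMk_left w).continuousAt.eventually (hU.mem_nhds h)

theorem eventually_mem_snd (hU : IsOpen U) (h : (z, w) ∈ U) : ∀ᶠ t in 𝓝 w, (z, t) ∈ U :=
  (Continuous.prodMk_right z).continuousAt.eventually (hU.mem_nhds h)

/-- Differentiates an identity valid on an open set: the derivatives of the two sides come as
explicit expressions from `HasDerivAt` rules, and uniqueness equates them. -/
theorem deriv_fst_unique (hU : IsOpen U) (hfg : ∀ z w, (z, w) ∈ U → f z w = g z w)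
    (h : (z, w) ∈ U) {a b : ℝ} (hf : HasDerivAt (fun t => f t w) a z)
    (hg : HasDerivAt (fun t => g t w) b z) : a = b :=
  (hf.congr_of_eventuallyEq ((eventually_mem_fst hU h).mono fun t ht =>
    (hfg t w ht).symm)).unique hg

theorem deriv_snd_unique (hU : IsOpen U) (hfg : ∀ z w, (z, w) ∈ U → f z w = g z w)
    (h : (z, w) ∈ U) {a b : ℝ} (hf : HasDerivAt (fun t => f z t) a w)
    (hg : HasDerivAt (fun t => g z t) b w) : a = b :=
  (hf.congr_of_eventuallyEq ((eventually_mem_snd hU h).mono fun t ht =>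
    (hfg z t ht).symm)).unique hg

theorem pz_congr (hU : IsOpen U) (hfg : ∀ z w, (z, w) ∈ U → f z w = g z w)
    (h : (z, w) ∈ U) : pz f z w = pz g z w :=
  Filter.EventuallyEq.deriv_eq ((eventually_mem_fst hU h).mono fun t ht => hfg t w ht)

theorem pw_congr (hU : IsOpen U) (hfg : ∀ z w, (z, w) ∈ U → f z w = g z w)
    (h : (z, w) ∈ U) : pw f z w = pw g z w :=
  Filter.EventuallyEq.deriv_eq ((eventually_mem_snd hU h).mono fun t ht => hfg z t ht)

/-- Mixed partial derivatives commute. -/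
theorem SmoothOn₂.pz_pw (hU : IsOpen U) (hf : SmoothOn₂ U f) (h : (z, w) ∈ U) :
    pz (pw f) z w = pw (pz f) z w := by
  set F : ℝ × ℝ → ℝ := fun x => f x.1 x.2
  have hF : ContDiffAt ℝ ∞ F (z, w) := hf.contDiffAt hU h
  have hd : DifferentiableAt ℝ (fderiv ℝ F) (z, w) :=
    (hF.fderiv_right (m := ∞) (by simp)).differentiableAt (by simp)
  have key (v : ℝ × ℝ) : HasFDerivAt (fun x => fderiv ℝ F x v)
      ((fderiv ℝ (fderiv ℝ F) (z, w)).flip v) (z, w) := by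
    simpa using hd.hasFDerivAt.clm_apply (hasFDerivAt_const v (z, w))
  have e1 : pz (pw f) z w = fderiv ℝ (fderiv ℝ F) (z, w) (1, 0) (0, 1) := by
    rw [pz_congr (g := fun z w => fderiv ℝ F (z, w) (0, 1)) hU
      (fun z w h => hf.pw_eq_fderiv hU h) h]
    exact ((key (0, 1)).comp_hasDerivAt (f := fun t => (t, w)) z
      ((hasDerivAt_id z).prodMk (hasDerivAt_const z w))).deriv
  have e2 : pw (pz f) z w = fderiv ℝ (fderiv ℝ F) (z, w) (0, 1) (1, 0) := by
    rw [pw_congr (g := fun z w => fderiv ℝ F (z, w) (1, 0)) hU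
      (fun z w h => hf.pz_eq_fderiv hU h) h]
    exact ((key (1, 0)).comp_hasDerivAt (f := fun t => (z, t)) w
      ((hasDerivAt_const w z).prodMk (hasDerivAt_id w))).deriv
  rw [e1, e2]
  exact (hF.isSymmSndFDerivAt (by
    simpa using WithTop.coe_le_coe.2 (le_top : (2 : ℕ∞) ≤ ⊤))).eq _ _

end

/-! ### Vanishing of Lie's invariants for pullbacks of linear equations. -/

/-- The coefficients of the cubic form are smooth on `U`. -/
structure CubicForm.SmoothOn (N : CubicForm) (U : Set (ℝ × ℝ)) : Prop where
  A : SmoothOn₂ U N.A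
  B : SmoothOn₂ U N.B
  C : SmoothOn₂ U N.C
  D : SmoothOn₂ U N.D

/-- Lie's invariants are the components of the Cotton tensor of a projective connection: if the
connection with components `X₂₂ = -A`, `Y₂₂ = B + 2 X`, `X₁₁ = 2 Y - C`, `Y₁₁ = D`, `X₁₂ = X`,
`Y₁₂ = Y` has curvature given by a Codazzi tensor `K`, then both invariants vanish. -/
theorem CubicForm.psi_eq_zero_of_codazzi {U : Set (ℝ × ℝ)} (hU : IsOpen U) {N : CubicForm}
    (hN : N.SmoothOn U) {X Y K₁₁ K₁₂ K₂₂ : ℝ → ℝ → ℝ} (hX : SmoothOn₂ U X) (hY : SmoothOn₂ U Y)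
    (hK₁₁ : SmoothOn₂ U K₁₁) (hK₁₂ : SmoothOn₂ U K₁₂) (hK₂₂ : SmoothOn₂ U K₂₂)
    (h₁ : ∀ z w, (z, w) ∈ U → 2 * pw Y z w - pw N.C z w - pz X z w - N.D z w * N.A z w
      - Y z w * X z w = -K₁₂ z w)
    (h₂ : ∀ z w, (z, w) ∈ U → pw N.D z w - pz Y z w + (2 * Y z w - N.C z w) * Y z w
      + N.D z w * (N.B z w + 2 * X z w) - X z w * N.D z w - Y z w * Y z w = K₁₁ z w)
    (h₃ : ∀ z w, (z, w) ∈ U → pw X z w + pz N.A z w + X z w * X z w - Y z w * N.A z w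
      + N.A z w * (2 * Y z w - N.C z w) - (N.B z w + 2 * X z w) * X z w = -K₂₂ z w)
    (h₄ : ∀ z w, (z, w) ∈ U → pw Y z w - pz N.B z w - 2 * pz X z w + X z w * Y z w
      + N.A z w * N.D z w = K₁₂ z w)
    (h₅ : ∀ z w, (z, w) ∈ U → pw K₁₁ z w - pz K₁₂ z w = X z w * K₁₁ z w + Y z w * K₁₂ z w
      - (2 * Y z w - N.C z w) * K₁₂ z w - N.D z w * K₂₂ z w)
    (h₆ : ∀ z w, (z, w) ∈ U → pw K₁₂ z w - pz K₂₂ z w = -N.A z w * K₁₁ z w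
      + (N.B z w + 2 * X z w) * K₁₂ z w - X z w * K₁₂ z w - Y z w * K₂₂ z w)
    {z w : ℝ} (h : (z, w) ∈ U) : N.Psi₁ z w = 0 ∧ N.Psi₂ z w = 0 := by
  obtain ⟨A, B, C, D⟩ := N
  obtain ⟨hA, hB, hC, hD⟩ := hN
  dsimp only at *
  have dz {f : ℝ → ℝ → ℝ} (hf : SmoothOn₂ U f) := hf.hasDerivAt_pz hU h
  have dw {f : ℝ → ℝ → ℝ} (hf : SmoothOn₂ U f) := hf.hasDerivAt_pw hU h
  have zz {f : ℝ → ℝ → ℝ} (hf : SmoothOn₂ U f) := (hf.partial_fst hU).hasDerivAt_pz hU h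
  have zw {f : ℝ → ℝ → ℝ} (hf : SmoothOn₂ U f) := (hf.partial_fst hU).hasDerivAt_pw hU h
  have wz {f : ℝ → ℝ → ℝ} (hf : SmoothOn₂ U f) : HasDerivAt (fun t => pw f t w)
      (pw (pz f) z w) z := hf.pz_pw hU h ▸ (hf.partial_snd hU).hasDerivAt_pz hU h
  have ww {f : ℝ → ℝ → ℝ} (hf : SmoothOn₂ U f) := (hf.partial_snd hU).hasDerivAt_pw hU h
  have e₁w := deriv_snd_unique hU h₁ h ((((((ww hY).const_mul 2).sub (ww hC)).sub (zw hX)).sub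
    ((dw hD).mul (dw hA))).sub ((dw hY).mul (dw hX))) (dw hK₁₂).neg
  have e₁z := deriv_fst_unique hU h₁ h ((((((wz hY).const_mul 2).sub (wz hC)).sub (zz hX)).sub
    ((dz hD).mul (dz hA))).sub ((dz hY).mul (dz hX))) (dz hK₁₂).neg
  have e₂w := deriv_snd_unique hU h₂ h ((((((ww hD).sub (zw hY)).add
    ((((dw hY).const_mul 2).sub (dw hC)).mul (dw hY))).add
    ((dw hD).mul ((dw hB).add ((dw hX).const_mul 2)))).sub ((dw hX).mul (dw hD))).sub
    ((dw hY).mul (dw hY))) (dw hK₁₁)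
  have e₃z := deriv_fst_unique hU h₃ h ((((((wz hX).add (zz hA)).add ((dz hX).mul (dz hX))).sub
    ((dz hY).mul (dz hA))).add ((dz hA).mul (((dz hY).const_mul 2).sub (dz hC)))).sub
    (((dz hB).add ((dz hX).const_mul 2)).mul (dz hX))) (dz hK₂₂).neg
  have e₄w := deriv_snd_unique hU h₄ h (((((ww hY).sub (zw hB)).sub ((zw hX).const_mul 2)).add
    ((dw hX).mul (dw hY))).add ((dw hA).mul (dw hD))) (dw hK₁₂)
  have e₄z := deriv_fst_unique hU h₄ h (((((wz hY).sub (zz hB)).sub ((zz hX).const_mul 2)).add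
    ((dz hX).mul (dz hY))).add ((dz hA).mul (dz hD))) (dz hK₁₂)
  have g₁ := h₁ z w h
  have g₂ := h₂ z w h
  have g₃ := h₃ z w h
  have g₄ := h₄ z w h
  have g₅ := h₅ z w h
  have g₆ := h₆ z w h
  have p₁ : pz (fun z w => C z w * A z w) z w = _ := ((dz hC).mul (dz hA)).deriv
  have p₂ : pw (fun z w => D z w * A z w) z w = _ := ((dw hD).mul (dw hA)).deriv
  have p₃ : pz (fun z w => B z w ^ 2) z w = _ := ((dz hB).pow 2).deriv
  have p₄ : pz (fun z w => D z w * A z w) z w = _ := ((dz hD).mul (dz hA)).deriv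
  have p₅ : pw (fun z w => D z w * B z w) z w = _ := ((dw hD).mul (dw hB)).deriv
  have p₆ : pw (fun z w => C z w ^ 2) z w = _ := ((dw hC).pow 2).deriv
  simp only [CubicForm.Psi₁, CubicForm.Psi₂, p₁, p₂, p₃, p₄, p₅, p₆]
  clear p₁ p₂ p₃ p₄ p₅ p₆ h₁ h₂ h₃ h₄ h₅ h₆
  simp only [Pi.add_apply, Pi.sub_apply] at e₂w e₃z
  push_cast
  constructor
  -- The multiples `-1, 3, 2` are those for which the second derivatives of `X` and `Y` cancel and
  -- `3 A_zz - 2 B_zw + C_ww` is left. The derivatives of `K` add up to `3 (∂_w K₁₂ - ∂_z K₂₂)`,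
  -- which the Codazzi equation `g₆` removes; the undifferentiated curvature equations absorb the
  -- lower-order terms.
  · linear_combination -e₁w + 3 * e₃z + 2 * e₄w + 3 * A z w * g₂ - 3 * Y z w * g₃
      - 3 * X z w * g₄ + B z w * (g₁ - 2 * g₄) + 3 * g₆
  -- Likewise `3, -1, 2` leave `3 D_ww - 2 C_zw + B_zz`, and `3 (∂_w K₁₁ - ∂_z K₁₂)` is removed by
  -- `g₅`.
  · linear_combination 3 * e₂w - e₄z + 2 * e₁z - 3 * D z w * g₃ - 3 * X z w * g₂
      - 3 * Y z w * g₁ + C z w * (2 * g₁ - g₄) + 3 * g₅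

/-- The algebraic part of the computation of the curvature of the connection which satisfies
`∇v = 0`, `∇²u = -α du dv - E dv²`. -/
theorem curvature_of_pullback {u₁ u₂ v₁ v₂ u₁₁ u₁₂ u₂₂ v₁₁ v₁₂ v₂₂ X₁₁ X₁₂ X₂₂ Y₁₁ Y₁₂ Y₂₂
    X₁₁' X₁₂' Y₁₁' Y₁₂' α E α' E' b : ℝ} (hJ : v₁ * u₂ - u₁ * v₂ ≠ 0)
    (hv₁₁ : v₁₁ = X₁₁ * v₁ + Y₁₁ * v₂) (hv₁₂ : v₁₂ = X₁₂ * v₁ + Y₁₂ * v₂)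
    (hv₂₂ : v₂₂ = X₂₂ * v₁ + Y₂₂ * v₂)
    (hu₁₁ : u₁₁ = X₁₁ * u₁ + Y₁₁ * u₂ - (α * v₁ * u₁ + E * (v₁ * v₁)))
    (hu₁₂ : u₁₂ = X₁₂ * u₁ + Y₁₂ * u₂ - (α / 2 * (v₁ * u₂ + v₂ * u₁) + E * (v₁ * v₂)))
    (hu₂₂ : u₂₂ = X₂₂ * u₁ + Y₂₂ * u₂ - (α * v₂ * u₂ + E * (v₂ * v₂)))
    (ev : X₁₁' * v₁ + X₁₁ * v₁₂ + (Y₁₁' * v₂ + Y₁₁ * v₂₂)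
      = X₁₂' * v₁ + X₁₂ * v₁₁ + (Y₁₂' * v₂ + Y₁₂ * v₁₂))
    (eu : X₁₁' * u₁ + X₁₁ * u₁₂ + (Y₁₁' * u₂ + Y₁₁ * u₂₂)
      - (α' * v₂ * v₁ * u₁ + α * v₁₂ * u₁ + α * v₁ * u₁₂ + (E' * v₂ + b * u₂) * (v₁ * v₁)
        + E * (2 * v₁ * v₁₂))
      = X₁₂' * u₁ + X₁₂ * u₁₁ + (Y₁₂' * u₂ + Y₁₂ * u₁₂)
      - (α' * v₁ / 2 * (v₁ * u₂ + v₂ * u₁) + α / 2 * (v₁₁ * u₂ + v₁ * u₁₂ + v₁₂ * u₁ + v₂ * u₁₁)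
        + (E' * v₁ + b * u₁) * (v₁ * v₂) + E * (v₁₁ * v₂ + v₁ * v₁₂))) :
    X₁₁' - X₁₂' + Y₁₁ * X₂₂ - Y₁₂ * X₁₂ = -((b - α' / 2 - α * α / 4) * (v₁ * v₂)) ∧
    Y₁₁' - Y₁₂' + X₁₁ * Y₁₂ + Y₁₁ * Y₂₂ - X₁₂ * Y₁₁ - Y₁₂ * Y₁₂
      = (b - α' / 2 - α * α / 4) * (v₁ * v₁) := by
  -- `ev` and `eu` say that the mixed third derivatives of `v` and `u` agree. The primes on `X₁₁`,
  -- `Y₁₁` stand for the derivative in the second variable, those on `X₁₂`, `Y₁₂` for the derivative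
  -- in the first. The two identities are linear in the two curvature components, with determinant
  -- the Jacobian, so Cramer's rule isolates each component.
  subst hv₁₁ hv₁₂ hv₂₂ hu₁₁ hu₁₂ hu₂₂
  constructor
  · refine mul_left_cancel₀ hJ ?_
    linear_combination u₂ * ev - v₂ * eu
  · refine mul_left_cancel₀ hJ ?_
    linear_combination v₁ * eu - u₁ * ev

/-- At `(z, w)`, the cubic form is the pullback of `Q'' + a(r) Q' + b(r) Q + c(r)` by
`Q = u(z, w)`, `r = v(z, w)`. -/
structure CubicForm.IsPullbackAt (N : CubicForm) (u v : ℝ → ℝ → ℝ) (a b c : ℝ → ℝ) (z w : ℝ) :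
    Prop where
  jac : pz v z w * pw u z w - pz u z w * pw v z w ≠ 0
  A : (pz v z w * pw u z w - pz u z w * pw v z w) * N.A z w
    = pw v z w * pw (pw u) z w - pw u z w * pw (pw v) z w
      + a (v z w) * pw v z w ^ 2 * pw u z w + (b (v z w) * u z w + c (v z w)) * pw v z w ^ 3
  B : (pz v z w * pw u z w - pz u z w * pw v z w) * N.B z w
    = pz v z w * pw (pw u) z w - pz u z w * pw (pw v) z w
      + 2 * (pw v z w * pw (pz u) z w - pw u z w * pw (pz v) z w)
      + a (v z w) * (pw v z w ^ 2 * pz u z w + 2 * pz v z w * pw v z w * pw u z w)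
      + 3 * (b (v z w) * u z w + c (v z w)) * pz v z w * pw v z w ^ 2
  C : (pz v z w * pw u z w - pz u z w * pw v z w) * N.C z w
    = pw v z w * pz (pz u) z w - pw u z w * pz (pz v) z w
      + 2 * (pz v z w * pw (pz u) z w - pz u z w * pw (pz v) z w)
      + a (v z w) * (pz v z w ^ 2 * pw u z w + 2 * pz v z w * pw v z w * pz u z w)
      + 3 * (b (v z w) * u z w + c (v z w)) * pz v z w ^ 2 * pw v z w
  D : (pz v z w * pw u z w - pz u z w * pw v z w) * N.D z w
    = pz v z w * pz (pz u) z w - pz u z w * pz (pz v) z w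
      + a (v z w) * pz v z w ^ 2 * pz u z w + (b (v z w) * u z w + c (v z w)) * pz v z w ^ 3

/-- Lie's invariants vanish for a pullback of a linear equation. -/
theorem CubicForm.psi_eq_zero_of_isPullbackAt {U : Set (ℝ × ℝ)} (hU : IsOpen U) {N : CubicForm}
    (hN : N.SmoothOn U) {u v : ℝ → ℝ → ℝ} (hu : SmoothOn₂ U u) (hv : SmoothOn₂ U v)
    {a b c : ℝ → ℝ} (ha : ∀ z w, (z, w) ∈ U → ContDiffAt ℝ ∞ a (v z w))
    (hb : ∀ z w, (z, w) ∈ U → ContDiffAt ℝ ∞ b (v z w))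
    (hc : ∀ z w, (z, w) ∈ U → ContDiffAt ℝ ∞ c (v z w))
    (hP : ∀ z w, (z, w) ∈ U → N.IsPullbackAt u v a b c z w) {z w : ℝ} (h : (z, w) ∈ U) :
    N.Psi₁ z w = 0 ∧ N.Psi₂ z w = 0 := by
  have hd {f : ℝ → ℝ} {x : ℝ} (hf : ContDiffAt ℝ ∞ f x) : ContDiffAt ℝ ∞ (deriv f) x := by
    have h1 := (hf.fderiv_right (m := ∞) (by simp)).clm_apply
      (contDiffAt_const (c := (1 : ℝ)))
    simpa only [fderiv_apply_one_eq_deriv] using h1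
  have cz {f : ℝ → ℝ} (hf : ∀ z w, (z, w) ∈ U → ContDiffAt ℝ ∞ f (v z w)) (z w : ℝ)
      (h : (z, w) ∈ U) :
      HasDerivAt (fun t => f (v t w)) (deriv f (v z w) * pz v z w) z :=
    ((hf z w h).differentiableAt (by simp)).hasDerivAt.comp z (hv.hasDerivAt_pz hU h)
  have cw {f : ℝ → ℝ} (hf : ∀ z w, (z, w) ∈ U → ContDiffAt ℝ ∞ f (v z w)) (z w : ℝ)
      (h : (z, w) ∈ U) :
      HasDerivAt (fun t => f (v z t)) (deriv f (v z w) * pw v z w) w :=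
    ((hf z w h).differentiableAt (by simp)).hasDerivAt.comp w (hv.hasDerivAt_pw hU h)
  set J : ℝ → ℝ → ℝ := fun z w => pz v z w * pw u z w - pz u z w * pw v z w with hJ
  set E : ℝ → ℝ → ℝ := fun z w => b (v z w) * u z w + c (v z w) with hE
  -- `X` and `Y` solve the linear system `X v_z + Y v_w = v_zw`, `X u_z + Y u_w = S`: these are the
  -- mixed components of the conditions imposed on `∇dv` and `∇du`. The other components then follow
  -- from the pullback formulas for `A`, `B`, `C`, `D`.
  set S : ℝ → ℝ → ℝ := fun z w => pw (pz u) z w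
    + (a (v z w) * (1 / 2) * (pz v z w * pw u z w + pw v z w * pz u z w)
      + E z w * (pz v z w * pw v z w)) with hS
  set X : ℝ → ℝ → ℝ := fun z w =>
    (pw u z w * pw (pz v) z w - pw v z w * S z w) / J z w with hX
  set Y : ℝ → ℝ → ℝ := fun z w =>
    (pz v z w * S z w - pz u z w * pw (pz v) z w) / J z w with hY
  -- The potential of the linear equation after its first-order term is removed by rescaling `Q`.
  set k : ℝ → ℝ := fun r => b r - deriv a r / 2 - a r * a r / 4 with hk
  have hkd : ∀ z w, (z, w) ∈ U → ContDiffAt ℝ ∞ k (v z w) := fun z w h =>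
    ((hb z w h).sub ((hd (ha z w h)).div_const 2)).sub (((ha z w h).mul (ha z w h)).div_const 4)
  have sv₁ := hv.partial_fst hU
  have sv₂ := hv.partial_snd hU
  have su₁ := hu.partial_fst hU
  have su₂ := hu.partial_snd hU
  have su₁₂ := su₁.partial_snd hU
  have sv₁₂ := sv₁.partial_snd hU
  have sJ : SmoothOn₂ U J := (sv₁.mul su₂).sub (su₁.mul sv₂)
  have sE : SmoothOn₂ U E := ((hv.comp hU hb).mul hu).add (hv.comp hU hc)
  have sS : SmoothOn₂ U S := su₁₂.add ((((hv.comp hU ha).mul (.const _)).mul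
    ((sv₁.mul su₂).add (sv₂.mul su₁))).add (sE.mul (sv₁.mul sv₂)))
  have J0 : ∀ z w, (z, w) ∈ U → J z w ≠ 0 := fun z w h => (hP z w h).jac
  have sX : SmoothOn₂ U X := ((su₂.mul sv₁₂).sub (sv₂.mul sS)).div sJ J0
  have sY : SmoothOn₂ U Y := ((sv₁.mul sS).sub (su₁.mul sv₁₂)).div sJ J0
  have sk : SmoothOn₂ U (fun z w => k (v z w)) := hv.comp hU hkd
  have eX : ∀ z w, (z, w) ∈ U →
      J z w * X z w = pw u z w * pw (pz v) z w - pw v z w * S z w := fun z w h => by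
    simp only [hX]; exact mul_div_cancel₀ _ (J0 z w h)
  have eY : ∀ z w, (z, w) ∈ U →
      J z w * Y z w = pz v z w * S z w - pz u z w * pw (pz v) z w := fun z w h => by
    simp only [hY]; exact mul_div_cancel₀ _ (J0 z w h)
  -- second derivatives of `u` and `v` in terms of the connection
  have v₁₁ : ∀ z w, (z, w) ∈ U →
      pz (pz v) z w = (2 * Y z w - N.C z w) * pz v z w + N.D z w * pw v z w := fun z w h => by
    refine mul_left_cancel₀ (J0 z w h) ?_
    have e₁ := eY z w h
    have e₂ := (hP z w h).C
    have e₃ := (hP z w h).D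
    simp only [hJ, hS, hE] at e₁ ⊢
    linear_combination -2 * pz v z w * e₁ + pz v z w * e₂ - pw v z w * e₃
  have v₁₂ : ∀ z w, (z, w) ∈ U →
      pw (pz v) z w = X z w * pz v z w + Y z w * pw v z w := fun z w h => by
    refine mul_left_cancel₀ (J0 z w h) ?_
    have e₁ := eX z w h
    have e₂ := eY z w h
    simp only [hJ] at e₁ e₂ ⊢
    linear_combination -pz v z w * e₁ - pw v z w * e₂
  have v₂₂ : ∀ z w, (z, w) ∈ U →
      pw (pw v) z w = -N.A z w * pz v z w + (N.B z w + 2 * X z w) * pw v z w := fun z w h => by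
    refine mul_left_cancel₀ (J0 z w h) ?_
    have e₁ := eX z w h
    have e₂ := (hP z w h).A
    have e₃ := (hP z w h).B
    simp only [hJ, hS, hE] at e₁ ⊢
    linear_combination -2 * pw v z w * e₁ + pz v z w * e₂ - pw v z w * e₃
  have u₁₁ : ∀ z w, (z, w) ∈ U →
      pz (pz u) z w = (2 * Y z w - N.C z w) * pz u z w + N.D z w * pw u z w
        - (a (v z w) * pz v z w * pz u z w + E z w * (pz v z w * pz v z w)) := fun z w h => by
    refine mul_left_cancel₀ (J0 z w h) ?_
    have e₁ := eY z w h
    have e₂ := (hP z w h).C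
    have e₃ := (hP z w h).D
    simp only [hJ, hS, hE] at e₁ ⊢
    linear_combination -2 * pz u z w * e₁ + pz u z w * e₂ - pw u z w * e₃
  have u₁₂ : ∀ z w, (z, w) ∈ U →
      pw (pz u) z w = X z w * pz u z w + Y z w * pw u z w
        - (a (v z w) * (1 / 2) * (pz v z w * pw u z w + pw v z w * pz u z w)
          + E z w * (pz v z w * pw v z w)) := fun z w h => by
    refine mul_left_cancel₀ (J0 z w h) ?_
    have e₁ := eX z w h
    have e₂ := eY z w h
    simp only [hJ, hS] at e₁ e₂ ⊢
    linear_combination -pz u z w * e₁ - pw u z w * e₂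
  have u₂₂ : ∀ z w, (z, w) ∈ U →
      pw (pw u) z w = -N.A z w * pz u z w + (N.B z w + 2 * X z w) * pw u z w
        - (a (v z w) * pw v z w * pw u z w + E z w * (pw v z w * pw v z w)) := fun z w h => by
    refine mul_left_cancel₀ (J0 z w h) ?_
    have e₁ := eX z w h
    have e₂ := (hP z w h).A
    have e₃ := (hP z w h).B
    simp only [hJ, hS, hE] at e₁ ⊢
    linear_combination -2 * pw u z w * e₁ + pz u z w * e₂ - pw u z w * e₃
  -- the curvature
  have R₁ : ∀ z w, (z, w) ∈ U →
      (2 * pw Y z w - pw N.C z w) - pz X z w + N.D z w * -N.A z w - Y z w * X z w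
        = -(k (v z w) * (pz v z w * pw v z w)) ∧
      pw N.D z w - pz Y z w + (2 * Y z w - N.C z w) * Y z w + N.D z w * (N.B z w + 2 * X z w)
        - X z w * N.D z w - Y z w * Y z w = k (v z w) * (pz v z w * pz v z w) := fun z w h => by
    have dz {f : ℝ → ℝ → ℝ} (hf : SmoothOn₂ U f) := hf.hasDerivAt_pz hU h
    have dw {f : ℝ → ℝ → ℝ} (hf : SmoothOn₂ U f) := hf.hasDerivAt_pw hU h
    have ev₁ := deriv_snd_unique hU v₁₁ h (dw (sv₁.partial_fst hU))
      (((((dw sY).const_mul 2).fun_sub (dw hN.C)).mul (dw sv₁)).add ((dw hN.D).mul (dw sv₂)))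
    have ev₂ := deriv_fst_unique hU v₁₂ h (dz (sv₁.partial_snd hU))
      (((dz sX).mul (dz sv₁)).add ((dz sY).mul (dz sv₂)))
    have eu₁ := deriv_snd_unique hU u₁₁ h (dw (su₁.partial_fst hU))
      ((((((dw sY).const_mul 2).fun_sub (dw hN.C)).mul (dw su₁)).add
        ((dw hN.D).mul (dw su₂))).sub ((((cw ha z w h).fun_mul (dw sv₁)).mul (dw su₁)).add
        ((((cw hb z w h).fun_mul (dw hu)).fun_add (cw hc z w h)).mul ((dw sv₁).fun_mul (dw sv₁)))))
    have eu₂ := deriv_fst_unique hU u₁₂ h (dz (su₁.partial_snd hU))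
      ((((dz sX).mul (dz su₁)).add ((dz sY).mul (dz su₂))).sub
        ((((cz ha z w h).mul_const (1 / 2)).mul
          (((dz sv₁).fun_mul (dz su₂)).fun_add ((dz sv₂).fun_mul (dz su₁)))).add
        ((((cz hb z w h).fun_mul (dz hu)).fun_add (cz hc z w h)).mul ((dz sv₁).fun_mul (dz sv₂)))))
    rw [sv₁.pz_pw hU h, ev₁] at ev₂
    rw [su₁.pz_pw hU h, eu₁] at eu₂
    rw [hv.pz_pw hU h] at ev₂ eu₂
    rw [hu.pz_pw hU h] at eu₂
    refine curvature_of_pullback (u₁₂ := pw (pz u) z w) (J0 z w h) (v₁₁ z w h) (v₁₂ z w h) (v₂₂ z w h)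
      (E := E z w) (E' := deriv b (v z w) * u z w + deriv c (v z w)) (α := a (v z w))
      (u₁₁ z w h) (by rw [u₁₂ z w h]; ring) (u₂₂ z w h) ?_ ?_
    · linear_combination ev₂
    · simp only [hE]
      linear_combination eu₂
  have R₂ : ∀ z w, (z, w) ∈ U →
      (pz N.B z w + 2 * pz X z w) - pw Y z w + -N.A z w * N.D z w - X z w * Y z w
        = -(k (v z w) * (pw v z w * pz v z w)) ∧
      -pz N.A z w - pw X z w + (N.B z w + 2 * X z w) * X z w + -N.A z w * (2 * Y z w - N.C z w)
        - Y z w * -N.A z w - X z w * X z w = k (v z w) * (pw v z w * pw v z w) := fun z w h => by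
    have dz {f : ℝ → ℝ → ℝ} (hf : SmoothOn₂ U f) := hf.hasDerivAt_pz hU h
    have dw {f : ℝ → ℝ → ℝ} (hf : SmoothOn₂ U f) := hf.hasDerivAt_pw hU h
    have ev₁ := deriv_fst_unique hU v₂₂ h (dz (sv₂.partial_snd hU))
      (((dz hN.A).fun_neg.mul (dz sv₁)).add (((dz hN.B).fun_add ((dz sX).const_mul 2)).mul (dz sv₂)))
    have ev₂ := deriv_snd_unique hU v₁₂ h (dw (sv₁.partial_snd hU))
      (((dw sX).mul (dw sv₁)).add ((dw sY).mul (dw sv₂)))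
    have eu₁ := deriv_fst_unique hU u₂₂ h (dz (su₂.partial_snd hU))
      ((((dz hN.A).fun_neg.mul (dz su₁)).add
        (((dz hN.B).fun_add ((dz sX).const_mul 2)).mul (dz su₂))).sub
        ((((cz ha z w h).fun_mul (dz sv₂)).mul (dz su₂)).add
        ((((cz hb z w h).fun_mul (dz hu)).fun_add (cz hc z w h)).mul ((dz sv₂).fun_mul (dz sv₂)))))
    have eu₂ := deriv_snd_unique hU u₁₂ h (dw (su₁.partial_snd hU))
      ((((dw sX).mul (dw su₁)).add ((dw sY).mul (dw su₂))).sub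
        ((((cw ha z w h).mul_const (1 / 2)).mul
          (((dw sv₁).fun_mul (dw su₂)).fun_add ((dw sv₂).fun_mul (dw su₁)))).add
        ((((cw hb z w h).fun_mul (dw hu)).fun_add (cw hc z w h)).mul ((dw sv₁).fun_mul (dw sv₂)))))
    rw [sv₂.pz_pw hU h, pw_congr hU (fun z w h => hv.pz_pw hU h) h, ev₂] at ev₁
    rw [su₂.pz_pw hU h, pw_congr hU (fun z w h => hu.pz_pw hU h) h, eu₂] at eu₁
    rw [hv.pz_pw hU h] at ev₁ eu₁
    rw [hu.pz_pw hU h] at eu₁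
    have hJ' : pw v z w * pz u z w - pw u z w * pz v z w ≠ 0 := fun h0 =>
      J0 z w h (by simp only [hJ]; linear_combination -h0)
    refine curvature_of_pullback hJ' (v₁₁ := pw (pw v) z w) (v₁₂ := pw (pz v) z w)
      (v₂₂ := pz (pz v) z w) (u₁₁ := pw (pw u) z w) (u₁₂ := pw (pz u) z w)
      (u₂₂ := pz (pz u) z w)
      (E := E z w) (E' := deriv b (v z w) * u z w + deriv c (v z w)) (α := a (v z w))
      (by rw [v₂₂ z w h]; ring) (by rw [v₁₂ z w h]; ring) (by rw [v₁₁ z w h]; ring)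
      (by rw [u₂₂ z w h]; ring) (by rw [u₁₂ z w h]; ring) (by rw [u₁₁ z w h]; ring) ?_ ?_
    · linear_combination -ev₁
    · simp only [hE]
      linear_combination -eu₁
  refine CubicForm.psi_eq_zero_of_codazzi hU hN sX sY (sk.mul (sv₁.mul sv₁))
    (sk.mul (sv₁.mul sv₂)) (sk.mul (sv₂.mul sv₂)) (fun z w h => ?_) (fun z w h => ?_)
    (fun z w h => ?_) (fun z w h => ?_) (fun z w h => ?_) (fun z w h => ?_) h
  · linear_combination (R₁ z w h).1
  · linear_combination (R₁ z w h).2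
  · linear_combination -(R₂ z w h).2
  · linear_combination -(R₂ z w h).1
  -- The Codazzi equations for `k(v) dv²`: the terms in `k'` are equal on both sides, and the rest
  -- is `∇dv = 0`.
  · have p₁ : pw (fun z w => k (v z w) * (pz v z w * pz v z w)) z w = _ := ((cw hkd z w h).mul
      (((sv₁.hasDerivAt_pw hU h)).fun_mul (sv₁.hasDerivAt_pw hU h))).deriv
    have p₂ : pz (fun z w => k (v z w) * (pz v z w * pw v z w)) z w = _ := ((cz hkd z w h).mul
      (((sv₁.hasDerivAt_pz hU h)).fun_mul (sv₂.hasDerivAt_pz hU h))).deriv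
    rw [p₁, p₂, hv.pz_pw hU h, v₁₁ z w h, v₁₂ z w h]
    ring
  · have p₁ : pw (fun z w => k (v z w) * (pz v z w * pw v z w)) z w = _ := ((cw hkd z w h).mul
      (((sv₁.hasDerivAt_pw hU h)).fun_mul (sv₂.hasDerivAt_pw hU h))).deriv
    have p₂ : pz (fun z w => k (v z w) * (pw v z w * pw v z w)) z w = _ := ((cz hkd z w h).mul
      (((sv₂.hasDerivAt_pz hU h)).fun_mul (sv₂.hasDerivAt_pz hU h))).deriv
    rw [p₁, p₂, hv.pz_pw hU h, v₁₂ z w h, v₂₂ z w h]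
    ring

/-! ### Transformation of the equation along curves. -/

theorem ContDiffAt.hasDerivAt_deriv_of_two {x : ℝ → ℝ} {r : ℝ} (hx : ContDiffAt ℝ 2 x r) :
    (∀ᶠ t in 𝓝 r, HasDerivAt x (deriv x t) t) ∧ HasDerivAt (deriv x) (deriv (deriv x) r) r := by
  constructor
  · filter_upwards [hx.eventually (by simp)] with t ht
    exact (ht.differentiableAt (by simp)).hasDerivAt
  · have h1 : ContDiffAt ℝ 1 (deriv x) r := by
      have h1 := (hx.fderiv_right (m := 1) (by norm_num)).clm_apply
        (contDiffAt_const (c := (1 : ℝ)))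
      simpa only [fderiv_apply_one_eq_deriv] using h1
    exact (h1.differentiableAt (by simp)).hasDerivAt

/-- First and second derivative of a function along a curve. -/
theorem SmoothOn₂.deriv_along {U : Set (ℝ × ℝ)} (hU : IsOpen U) {f : ℝ → ℝ → ℝ}
    (hf : SmoothOn₂ U f) {x y F : ℝ → ℝ} {r : ℝ} (h : (x r, y r) ∈ U)
    (hx : ContDiffAt ℝ 2 x r) (hy : ContDiffAt ℝ 2 y r)
    (hF : ∀ᶠ t in 𝓝 r, f (x t) (y t) = F t) :
    pz f (x r) (y r) * deriv x r + pw f (x r) (y r) * deriv y r = deriv F r ∧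
    pz (pz f) (x r) (y r) * deriv x r ^ 2 + 2 * pw (pz f) (x r) (y r) * deriv x r * deriv y r
      + pw (pw f) (x r) (y r) * deriv y r ^ 2 + pz f (x r) (y r) * deriv (deriv x) r
      + pw f (x r) (y r) * deriv (deriv y) r = deriv (deriv F) r := by
  obtain ⟨hx₁, hx₂⟩ := hx.hasDerivAt_deriv_of_two
  obtain ⟨hy₁, hy₂⟩ := hy.hasDerivAt_deriv_of_two
  have hmem : ∀ᶠ t in 𝓝 r, (x t, y t) ∈ U :=
    (hx.continuousAt.prodMk hy.continuousAt).eventually (hU.mem_nhds h)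
  have key : ∀ᶠ t in 𝓝 r,
      pz f (x t) (y t) * deriv x t + pw f (x t) (y t) * deriv y t = deriv F t := by
    filter_upwards [hx₁, hy₁, hmem, hF.eventually_nhds] with t h1 h2 h3 h4
    rw [← (hf.hasDerivAt_comp hU h3 h1 h2).deriv]
    exact Filter.EventuallyEq.deriv_eq h4
  refine ⟨key.self_of_nhds, ?_⟩
  rw [← Filter.EventuallyEq.deriv_eq key]
  have h1 := ((hf.partial_fst hU).hasDerivAt_comp hU h hx₁.self_of_nhds hy₁.self_of_nhds).fun_mul
    hx₂
  have h2 := ((hf.partial_snd hU).hasDerivAt_comp hU h hx₁.self_of_nhds hy₁.self_of_nhds).fun_mul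
    hy₂
  rw [(h1.fun_add h2).deriv, hf.pz_pw hU h]
  ring

/-- The second derivative along a curve which is a graph in the coordinates `(u, v)`. -/
theorem second_deriv_of_graph {U : Set (ℝ × ℝ)} (hU : IsOpen U) {u v : ℝ → ℝ → ℝ}
    (hu : SmoothOn₂ U u) (hv : SmoothOn₂ U v) {x y Q : ℝ → ℝ} {r : ℝ} (h : (x r, y r) ∈ U)
    (hx : ContDiffAt ℝ 2 x r) (hy : ContDiffAt ℝ 2 y r)
    (hQ : ∀ᶠ t in 𝓝 r, u (x t) (y t) = Q t) (hr : ∀ᶠ t in 𝓝 r, v (x t) (y t) = t)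
    (hx' : deriv x r ≠ 0) :
    pz v (x r) (y r) * deriv x r + pw v (x r) (y r) * deriv y r = 1 ∧
    pz u (x r) (y r) * deriv x r + pw u (x r) (y r) * deriv y r = deriv Q r ∧
    (pz v (x r) (y r) * pw u (x r) (y r) - pz u (x r) (y r) * pw v (x r) (y r)) *
        deriv x r ^ 3 * (deriv (fun t => deriv y t / deriv x t) r / deriv x r)
      = deriv (deriv Q) r
        - (pz (pz u) (x r) (y r) * deriv x r ^ 2
          + 2 * pw (pz u) (x r) (y r) * deriv x r * deriv y r
          + pw (pw u) (x r) (y r) * deriv y r ^ 2)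
        + deriv Q r * (pz (pz v) (x r) (y r) * deriv x r ^ 2
          + 2 * pw (pz v) (x r) (y r) * deriv x r * deriv y r
          + pw (pw v) (x r) (y r) * deriv y r ^ 2) := by
  obtain ⟨u₁, u₂⟩ := hu.deriv_along hU h hx hy hQ
  obtain ⟨v₁, v₂⟩ := hv.deriv_along hU h hx hy hr
  simp only [deriv_id'', deriv_const] at v₁ v₂
  refine ⟨v₁, u₁, ?_⟩
  have hd := (hy.hasDerivAt_deriv_of_two.2.fun_div hx.hasDerivAt_deriv_of_two.2 hx').deriv
  rw [hd]
  field_simp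
  -- Of the second-order identities for `u` and `v`, take `v_t` times the first minus `u_t` times
  -- the second, where `v_t = 1` and `u_t = Q'`. The second derivatives of `x` and `y` then occur
  -- only as the Jacobian times `x' y'' - y' x''`.
  linear_combination (deriv (deriv Q) r - (pz (pz u) (x r) (y r) * deriv x r ^ 2
          + 2 * pw (pz u) (x r) (y r) * deriv x r * deriv y r
          + pw (pw u) (x r) (y r) * deriv y r ^ 2)) * v₁ + (pz v (x r) (y r) * deriv x r
          + pw v (x r) (y r) * deriv y r) * u₂ - (pz u (x r) (y r) * deriv x r
          + pw u (x r) (y r) * deriv y r) * v₂ + (pz (pz v) (x r) (y r) * deriv x r ^ 2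
          + 2 * pw (pz v) (x r) (y r) * deriv x r * deriv y r
          + pw (pw v) (x r) (y r) * deriv y r ^ 2) * u₁

/-- The cubic equation is transformed into the linear one. -/
theorem CubicForm.IsPullbackAt.transform {N : CubicForm} {U : Set (ℝ × ℝ)} (hU : IsOpen U)
    {u v : ℝ → ℝ → ℝ} (hu : SmoothOn₂ U u) (hv : SmoothOn₂ U v) {a b c x y Q : ℝ → ℝ} {r : ℝ}
    (h : (x r, y r) ∈ U) (hP : N.IsPullbackAt u v a b c (x r) (y r))
    (hx : ContDiffAt ℝ 2 x r) (hy : ContDiffAt ℝ 2 y r)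
    (hQ : ∀ᶠ t in 𝓝 r, u (x t) (y t) = Q t) (hr : ∀ᶠ t in 𝓝 r, v (x t) (y t) = t)
    (hx' : deriv x r ≠ 0) :
    deriv (fun t => deriv y t / deriv x t) r / deriv x r
      + N.A (x r) (y r) * (deriv y r / deriv x r) ^ 3
      + N.B (x r) (y r) * (deriv y r / deriv x r) ^ 2
      + N.C (x r) (y r) * (deriv y r / deriv x r) + N.D (x r) (y r) = 0 ↔
    deriv (deriv Q) r + a r * deriv Q r + b r * Q r + c r = 0 := by
  obtain ⟨e₁, e₂, e₃⟩ := second_deriv_of_graph hU hu hv h hx hy hQ hr hx'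
  have hJ := hP.jac
  have eA := hP.A
  have eB := hP.B
  have eC := hP.C
  have eD := hP.D
  rw [hr.self_of_nhds, hQ.self_of_nhds] at eA eB eC eD
  have hp : deriv y r = deriv y r / deriv x r * deriv x r := (div_mul_cancel₀ _ hx').symm
  generalize deriv y r / deriv x r = p at *
  generalize deriv (fun t => deriv y t / deriv x t) r / deriv x r = w₂ at *
  generalize deriv x r = X at *
  rw [hp] at e₁ e₂ e₃
  rw [← e₂] at e₃ ⊢
  have e₁' : X * (pz v (x r) (y r) + pw v (x r) (y r) * p) = 1 := by linear_combination e₁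
  have key : (pz v (x r) (y r) * pw u (x r) (y r) - pz u (x r) (y r) * pw v (x r) (y r)) * X ^ 3 *
      (w₂ + N.A (x r) (y r) * p ^ 3 + N.B (x r) (y r) * p ^ 2 + N.C (x r) (y r) * p
        + N.D (x r) (y r)) =
      deriv (deriv Q) r + a r * (pz u (x r) (y r) * X + pw u (x r) (y r) * (p * X)) + b r * Q r
        + c r := by
    -- Since `X * d = 1`, powers of `X * d` may be inserted to match degrees in `X`. The factors `1
    -- + X * d` and `1 + X * d + (X * d) ^ 2` come from factoring `(X * d) ^ 2 - 1` and `(X * d) ^ 3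
    -- - 1`.
    set d := pz v (x r) (y r) + pw v (x r) (y r) * p with hd
    linear_combination e₃ + X ^ 3 * (p ^ 3 * eA + p ^ 2 * eB + p * eC + eD)
      + (X ^ 2 * (pz (pz u) (x r) (y r) + 2 * pw (pz u) (x r) (y r) * p
          + pw (pw u) (x r) (y r) * p ^ 2)
        + a r * (pz u (x r) (y r) * X + pw u (x r) (y r) * (p * X)) * (1 + X * d)
        + (b r * Q r + c r) * (1 + X * d + (X * d) ^ 2)) * e₁'
  rw [← key]
  simp [hJ, hx']

/-- At most one slope `p` is excluded, and a cubic polynomial with four distinct zeros is zero. The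
excluded slope is that of the level curve of `v`, along which a curve is not a graph over `r`. -/
theorem cubic_coeff_eq_zero {c₀ c₁ c₂ c₃ v₁ v₂ : ℝ} (hv : v₁ ≠ 0 ∨ v₂ ≠ 0)
    (h : ∀ p, v₁ + v₂ * p ≠ 0 → c₃ * p ^ 3 + c₂ * p ^ 2 + c₁ * p + c₀ = 0) :
    c₃ = 0 ∧ c₂ = 0 ∧ c₁ = 0 ∧ c₀ = 0 := by
  obtain ⟨q, hq⟩ : ∃ q : ℝ, ∀ p, p ≠ q → v₁ + v₂ * p ≠ 0 := by
    by_cases h2 : v₂ = 0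
    · exact ⟨0, fun p _ => by simpa [h2] using hv⟩
    · refine ⟨-v₁ / v₂, fun p hp h0 => hp ?_⟩
      field_simp
      linear_combination h0
  have f₁ := h (q + 1) (hq _ (by simp))
  have f₂ := h (q + 2) (hq _ (by simp))
  have f₃ := h (q - 1) (hq _ (by simp))
  have f₄ := h (q - 2) (hq _ (by simp))
  have e₃ : c₃ = 0 := by linear_combination (f₂ - f₄ - 2 * (f₁ - f₃)) / 12
  have e₂ : c₂ = 0 := by linear_combination (f₂ + f₄ - f₁ - f₃) / 6 - 3 * q * e₃
  have e₁ : c₁ = 0 := by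
    linear_combination (f₁ - f₃) / 2 - 2 * q * e₂ - (3 * q ^ 2 + 1) * e₃
  exact ⟨e₃, e₂, e₁, by
    linear_combination f₁ - (q + 1) * e₁ - (q + 1) ^ 2 * e₂ - (q + 1) ^ 3 * e₃⟩

/-- The Jacobian determinant of a diffeomorphism does not vanish. -/
theorem OpenPartialHomeomorph.jacobian_ne_zero {T : OpenPartialHomeomorph (ℝ × ℝ) (ℝ × ℝ)}
    (hT : ContDiffOn ℝ ∞ T T.source) (hS : ContDiffOn ℝ ∞ T.symm T.target) {z w : ℝ}
    (h : (z, w) ∈ T.target) :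
    pz (fun z w => (T.symm (z, w)).2) z w * pw (fun z w => (T.symm (z, w)).1) z w
      - pz (fun z w => (T.symm (z, w)).1) z w * pw (fun z w => (T.symm (z, w)).2) z w ≠ 0 := by
  set u : ℝ → ℝ → ℝ := fun z w => (T.symm (z, w)).1 with hu
  set v : ℝ → ℝ → ℝ := fun z w => (T.symm (z, w)).2 with hv
  have su : SmoothOn₂ T.target u := contDiff_fst.comp_contDiffOn hS
  have sv : SmoothOn₂ T.target v := contDiff_snd.comp_contDiffOn hS
  have sf : SmoothOn₂ T.source (fun z w => (T (z, w)).1) := contDiff_fst.comp_contDiffOn hT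
  have sg : SmoothOn₂ T.source (fun z w => (T (z, w)).2) := contDiff_snd.comp_contDiffOn hT
  have ho := T.open_target
  have hm : (u z w, v z w) ∈ T.source := T.map_target h
  have e₁ := deriv_fst_unique (f := fun z w => (T (u z w, v z w)).1) (g := fun z _ => z)
    ho (fun z w h => by simp [u, v, T.right_inv h]) h
    (sf.hasDerivAt_comp T.open_source (x := fun t => u t w) (y := fun t => v t w) hm
    (su.hasDerivAt_pz ho h) (sv.hasDerivAt_pz ho h)) (hasDerivAt_id z)
  have e₂ := deriv_snd_unique (f := fun z w => (T (u z w, v z w)).1) (g := fun z _ => z)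
    ho (fun z w h => by simp [u, v, T.right_inv h]) h
    (sf.hasDerivAt_comp T.open_source (x := fun t => u z t) (y := fun t => v z t) hm
    (su.hasDerivAt_pw ho h) (sv.hasDerivAt_pw ho h)) (hasDerivAt_const w z)
  have e₃ := deriv_fst_unique (f := fun z w => (T (u z w, v z w)).2) (g := fun _ w => w)
    ho (fun z w h => by simp [u, v, T.right_inv h]) h
    (sg.hasDerivAt_comp T.open_source (x := fun t => u t w) (y := fun t => v t w) hm
    (su.hasDerivAt_pz ho h) (sv.hasDerivAt_pz ho h)) (hasDerivAt_const z w)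
  have e₄ := deriv_snd_unique (f := fun z w => (T (u z w, v z w)).2) (g := fun _ w => w)
    ho (fun z w h => by simp [u, v, T.right_inv h]) h
    (sg.hasDerivAt_comp T.open_source (x := fun t => u z t) (y := fun t => v z t) hm
    (su.hasDerivAt_pw ho h) (sv.hasDerivAt_pw ho h)) (hasDerivAt_id w)
  intro h0
  generalize pz u z w = u₁ at *
  generalize pw u z w = u₂ at *
  generalize pz v z w = v₁ at *
  generalize pw v z w = v₂ at *
  generalize pz (fun z w => (T (z, w)).1) (u z w) (v z w) = F₁ at *
  generalize pw (fun z w => (T (z, w)).1) (u z w) (v z w) = F₂ at *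
  generalize pz (fun z w => (T (z, w)).2) (u z w) (v z w) = G₁ at *
  generalize pw (fun z w => (T (z, w)).2) (u z w) (v z w) = G₂ at *
  -- By `e₁` to `e₄` the Jacobian matrices of `T` and of its inverse have the identity as product,
  -- so their determinants multiply to `1`.
  have : (1 : ℝ) = 0 := by
    linear_combination -e₄ * (F₁ * u₁ + F₂ * v₁) - e₁ + (G₁ * u₁ + G₂ * v₁) * e₂ + (G₁ * F₂ - F₁ * G₂) * h0
  exact one_ne_zero this

/-! ### Linearizability and pullbacks of linear equations. -/

namespace SecondOrderODE

theorem HasCubicForm.smoothOn {E : SecondOrderODE} {N : CubicForm} (h : E.HasCubicForm N) :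
    N.SmoothOn E.dom := ⟨h.1, h.2.1, h.2.2.1, h.2.2.2.1⟩

/-- Lie's linearization test, necessity. -/
theorem LinearizableAt.psi_eq_zero {E : SecondOrderODE} {N : CubicForm} (hN : E.HasCubicForm N)
    {p : ℝ × ℝ} (hp : E.LinearizableAt p) :
    ∃ V : Set (ℝ × ℝ), IsOpen V ∧ p ∈ V ∧ V ⊆ E.dom ∧
      ∀ z w, (z, w) ∈ V → N.Psi₁ z w = 0 ∧ N.Psi₂ z w = 0 := by
  obtain ⟨T, a, b, c, hpT, hTE, hT, hS, habc, hlin⟩ := hp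
  have ho := T.open_target
  set u : ℝ → ℝ → ℝ := fun z w => (T.symm (z, w)).1 with hu
  set v : ℝ → ℝ → ℝ := fun z w => (T.symm (z, w)).2 with hv
  have su : SmoothOn₂ T.target u := contDiff_fst.comp_contDiffOn hS
  have sv : SmoothOn₂ T.target v := contDiff_snd.comp_contDiffOn hS
  have hNs := hN.smoothOn
  have hmem : ∀ {z w}, (z, w) ∈ T.target → (u z w, v z w) ∈ T.source := fun h => T.map_target h
  refine ⟨T.target, ho, hpT, hTE, fun z w h => CubicForm.psi_eq_zero_of_isPullbackAt ho
    ⟨hNs.A.mono hTE, hNs.B.mono hTE, hNs.C.mono hTE, hNs.D.mono hTE⟩ su sv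
    (fun z w h => (habc _ (hmem h)).1) (fun z w h => (habc _ (hmem h)).2.1)
    (fun z w h => (habc _ (hmem h)).2.2) (fun z w h => ?_) h⟩
  have hJ : pz v z w * pw u z w - pz u z w * pw v z w ≠ 0 :=
    OpenPartialHomeomorph.jacobian_ne_zero hT hS h
  have hv0 : pz v z w ≠ 0 ∨ pw v z w ≠ 0 := by
    by_contra! h0
    exact hJ (by rw [h0.1, h0.2]; ring)
  set J := pz v z w * pw u z w - pz u z w * pw v z w with hJdef
  set Ev := b (v z w) * u z w + c (v z w) with hEv
  have key : ∀ p, pz v z w + pw v z w * p ≠ 0 →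
      (J * N.A z w - (pw v z w * pw (pw u) z w - pw u z w * pw (pw v) z w
        + a (v z w) * pw v z w ^ 2 * pw u z w + Ev * pw v z w ^ 3)) * p ^ 3
      + (J * N.B z w - (pz v z w * pw (pw u) z w - pz u z w * pw (pw v) z w
        + 2 * (pw v z w * pw (pz u) z w - pw u z w * pw (pz v) z w)
        + a (v z w) * (pw v z w ^ 2 * pz u z w + 2 * pz v z w * pw v z w * pw u z w)
        + 3 * Ev * pz v z w * pw v z w ^ 2)) * p ^ 2
      + (J * N.C z w - (pw v z w * pz (pz u) z w - pw u z w * pz (pz v) z w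
        + 2 * (pz v z w * pw (pz u) z w - pz u z w * pw (pz v) z w)
        + a (v z w) * (pz v z w ^ 2 * pw u z w + 2 * pz v z w * pw v z w * pz u z w)
        + 3 * Ev * pz v z w ^ 2 * pw v z w)) * p
      + (J * N.D z w - (pz v z w * pz (pz u) z w - pz u z w * pz (pz v) z w
        + a (v z w) * pz v z w ^ 2 * pz u z w + Ev * pz v z w ^ 3)) = 0 := by
    intro p hd
    set d := pz v z w + pw v z w * p with hddef
    -- `q₁` is the value of `Q'` for which the transformed curve has slope `p` at `(z, w)`, and `q₂`
    -- is the value of `Q''` which the linear equation then forces at `r`. The quadratic polynomial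
    -- with this 2-jet is enough, because the equivalence of the equations is a pointwise statement.
    set q₁ := (pz u z w + pw u z w * p) / d with hq₁
    set q₂ := -(a (v z w) * q₁ + Ev) with hq₂
    set r := v z w with hrdef
    set Q : ℝ → ℝ := fun t => u z w + q₁ * (t - r) + q₂ / 2 * (t - r) ^ 2 with hQdef
    have hQr : Q r = u z w := by simp [Q]
    have hQd : ∀ t, HasDerivAt Q (q₁ + q₂ * (t - r)) t := fun t => by
      have h1 := (hasDerivAt_id t).sub_const r
      refine (((h1.const_mul q₁).const_add (u z w)).add ((h1.pow 2).const_mul (q₂ / 2))).congr_deriv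
        ?_
      simp
      ring
    have hQ' : deriv Q = fun t => q₁ + q₂ * (t - r) := funext fun t => (hQd t).deriv
    have hQ'' : deriv (deriv Q) r = q₂ := by
      rw [hQ']
      refine HasDerivAt.deriv ((((((hasDerivAt_id r).sub_const r).const_mul q₂)).const_add
        q₁).congr_deriv (by simp))
    have hQs : ContDiff ℝ ∞ Q := by
      simp only [hQdef]
      fun_prop
    have hsrc : (Q r, r) ∈ T.source := by rw [hQr]; exact hmem h
    have hTQ : ContDiffAt ℝ ∞ (fun t => T (Q t, t)) r :=
      (hT.contDiffAt (T.open_source.mem_nhds hsrc)).comp (f := fun t => (Q t, t)) r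
        (hQs.contDiffAt.prodMk contDiffAt_id)
    set x : ℝ → ℝ := fun t => (T (Q t, t)).1 with hx
    set y : ℝ → ℝ := fun t => (T (Q t, t)).2 with hy
    have hTr : T (Q r, r) = (z, w) := by rw [hQr]; exact T.right_inv h
    have hxr : x r = z := by simp only [hx, hTr]
    have hyr : y r = w := by simp only [hy, hTr]
    have h2 : (2 : WithTop ℕ∞) ≤ ∞ := ENat.LEInfty.out
    have hxs : ContDiffAt ℝ 2 x r := (contDiffAt_fst.comp r hTQ).of_le h2
    have hys : ContDiffAt ℝ 2 y r := (contDiffAt_snd.comp r hTQ).of_le h2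
    have hev : ∀ᶠ t in 𝓝 r, (Q t, t) ∈ T.source :=
      (hQs.continuous.prodMk continuous_id).continuousAt.eventually
        (T.open_source.mem_nhds hsrc)
    have huQ : ∀ᶠ t in 𝓝 r, u (x t) (y t) = Q t := hev.mono fun t ht => by
      simp only [hu, hx, hy, Prod.mk.eta, T.left_inv ht]
    have hvQ : ∀ᶠ t in 𝓝 r, v (x t) (y t) = t := hev.mono fun t ht => by
      simp only [hv, hx, hy, Prod.mk.eta, T.left_inv ht]
    have hxy : (x r, y r) ∈ T.target := by rw [hxr, hyr]; exact h
    have d₁ := (su.deriv_along ho hxy hxs hys huQ).1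
    have d₂ := (sv.deriv_along ho hxy hxs hys hvQ).1
    have hq : q₁ * d = pz u z w + pw u z w * p := div_mul_cancel₀ _ hd
    have hQ1 : deriv Q r = q₁ := by simp [hQ']
    rw [hxr, hyr, hQ1] at d₁
    rw [hxr, hyr, deriv_id''] at d₂
    have ex : deriv x r = 1 / d := by
      refine mul_left_cancel₀ hJ ?_
      rw [mul_one_div, eq_div_iff hd, hJdef]
      linear_combination d * pw u z w * d₂ - d * pw v z w * d₁ - pw v z w * hq
    have ey : deriv y r = p * (1 / d) := by
      refine mul_left_cancel₀ hJ ?_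
      rw [← mul_assoc, mul_one_div, eq_div_iff hd, hJdef]
      linear_combination d * pz v z w * d₁ - d * pz u z w * d₂ + pz v z w * hq
    have hx0 : deriv x r ≠ 0 := by rw [ex]; exact one_div_ne_zero hd
    obtain ⟨-, -, e₃⟩ := second_deriv_of_graph ho su sv hxy hxs hys huQ hvQ hx0
    have e₄ := hlin Q r hsrc (hQs.of_le h2).contDiffAt
    simp only at e₄
    have e₅ := (e₄ hx0).2 (by rw [hQ'', hQr, hQ1]; simp only [hq₂, hEv]; ring)
    have e₆ := (hN.2.2.2.2 _ _ (hTE hxy) _ _).1 e₅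
    rw [hxr, hyr] at e₃ e₆
    rw [hQ'', hQ1] at e₃
    have hp : deriv y r / deriv x r = p := by rw [ex, ey]; field_simp
    rw [hp] at e₆
    set w₂ := deriv (fun t => deriv y t / deriv x t) r / deriv x r with hw₂
    rw [ex, ey, hq₂] at e₃
    -- The second derivative of the curve is now known twice: from the cubic equation, and from the
    -- chain rule with `Q'' = q₂`. Comparing them gives the cubic identity in `p`.
    have e₇ := eq_neg_of_add_eq_zero_left
      (by linear_combination e₆ : w₂ + (N.A z w * p ^ 3 + N.B z w * p ^ 2 + N.C z w * p
        + N.D z w) = 0)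
    rw [e₇, hq₁] at e₃
    rw [← hJdef] at e₃
    field_simp at e₃
    rw [hddef] at e₃
    linear_combination -e₃
  obtain ⟨kA, kB, kC, kD⟩ := cubic_coeff_eq_zero hv0 key
  exact ⟨hJ, sub_eq_zero.1 kA, sub_eq_zero.1 kB, sub_eq_zero.1 kC, sub_eq_zero.1 kD⟩

/-- An equation is linearizable where it is a pullback of a linear equation. -/
theorem linearizableAt_of_isPullbackAt {E : SecondOrderODE} {N : CubicForm}
    (hN : E.HasCubicForm N) {U : Set (ℝ × ℝ)} (hU : IsOpen U) (hUE : U ⊆ E.dom)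
    {u v : ℝ → ℝ → ℝ} (hu : SmoothOn₂ U u) (hv : SmoothOn₂ U v) {a b c : ℝ → ℝ}
    (habc : ∀ z w, (z, w) ∈ U → ContDiffAt ℝ ∞ a (v z w) ∧ ContDiffAt ℝ ∞ b (v z w) ∧
      ContDiffAt ℝ ∞ c (v z w))
    (hP : ∀ z w, (z, w) ∈ U → N.IsPullbackAt u v a b c z w) {p : ℝ × ℝ} (hp : p ∈ U) :
    E.LinearizableAt p := by
  set F : ℝ × ℝ → ℝ × ℝ := fun x => (u x.1 x.2, v x.1 x.2) with hF
  have hFs : ContDiffOn ℝ ∞ F U := ContDiffOn.prodMk hu hv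
  -- Invertibility is needed at every point of `U`, not only at `p`: the local inverse has to be
  -- smooth on its whole domain.
  have hequiv : ∀ x ∈ U, ∃ e : (ℝ × ℝ) ≃L[ℝ] (ℝ × ℝ), HasFDerivAt F (e : (ℝ × ℝ) →L[ℝ] ℝ × ℝ) x := by
    rintro ⟨z, w⟩ hx
    set L := (fderiv ℝ (fun x : ℝ × ℝ => u x.1 x.2) (z, w)).prod
      (fderiv ℝ (fun x : ℝ × ℝ => v x.1 x.2) (z, w)) with hL
    have hLF : HasFDerivAt F L (z, w) := (hu.hasFDerivAt hU hx).prodMk (hv.hasFDerivAt hU hx)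
    have happ : ∀ s t : ℝ, L (s, t) =
        (pz u z w * s + pw u z w * t, pz v z w * s + pw v z w * t) := fun s t => by
      rw [show ((s, t) : ℝ × ℝ) = s • (1, 0) + t • (0, 1) by simp, map_add, map_smul, map_smul]
      simp [hL, hu.pz_eq_fderiv hU hx, hu.pw_eq_fderiv hU hx, hv.pz_eq_fderiv hU hx,
        hv.pw_eq_fderiv hU hx, mul_comm]
    have hinj : Function.Injective (L : (ℝ × ℝ) →ₗ[ℝ] ℝ × ℝ) := by
      rw [injective_iff_map_eq_zero]
      rintro ⟨s, t⟩ h0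
      have h1 : L (s, t) = 0 := h0
      rw [happ, Prod.mk_eq_zero] at h1
      have hJ := (hP z w hx).jac
      have hs : s = 0 := mul_left_cancel₀ hJ (by
        linear_combination pw u z w * h1.2 - pw v z w * h1.1)
      have ht : t = 0 := mul_left_cancel₀ hJ (by
        linear_combination pz v z w * h1.1 - pz u z w * h1.2)
      rw [hs, ht]; rfl
    refine ⟨(LinearEquiv.ofInjectiveEndo _ hinj).toContinuousLinearEquiv, ?_⟩
    convert hLF using 1
    ext <;> rfl
  obtain ⟨e, he⟩ := hequiv p hp
  have hFp : ContDiffAt ℝ ∞ F p := hFs.contDiffAt (hU.mem_nhds hp)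
  set S₀ := hFp.toOpenPartialHomeomorph F he (by simp) with hS₀
  set S := S₀.restrOpen U hU with hSdef
  have hSF : ∀ x, S x = F x := fun x => rfl
  have hSU : ∀ x ∈ S.source, x ∈ U := fun x hx => hx.2
  have hsymm : ∀ y ∈ S.target, S.symm y ∈ U := fun y hy => hSU _ (S.map_target hy)
  have hleft : ∀ y ∈ S.target, F (S.symm y) = y := fun y hy => S.right_inv hy
  have hTs : ContDiffOn ℝ ∞ S.symm S.target := fun y hy => by
    obtain ⟨e', he'⟩ := hequiv _ (hsymm y hy)
    exact (S.contDiffAt_symm hy he' (hFs.contDiffAt (hU.mem_nhds (hsymm y hy)))).contDiffWithinAt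
  -- The transformation sought goes from `(Q, r)` to `(z, w)`, so it is the inverse of the local
  -- diffeomorphism `(u, v)`.
  refine ⟨S.symm, a, b, c, ⟨hFp.mem_toOpenPartialHomeomorph_source he (by simp), hp⟩,
    fun x hx => hUE (hSU x hx), hTs, hFs.mono hSU, fun y hy => ?_, fun Q r hsrc hQ => ?_⟩
  · have h1 := habc (S.symm y).1 (S.symm y).2 (hsymm y hy)
    rwa [show v (S.symm y).1 (S.symm y).2 = y.2 from congrArg Prod.snd (hleft y hy)] at h1
  · intro x y x₁ x₂ hx0
    have hTQ : ContDiffAt ℝ 2 (fun t => S.symm (Q t, t)) r :=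
      ((hTs.contDiffAt (S.open_target.mem_nhds hsrc)).of_le ENat.LEInfty.out).comp
        (f := fun t => (Q t, t)) r (hQ.prodMk contDiffAt_id)
    have hxs : ContDiffAt ℝ 2 x r := contDiffAt_fst.comp r hTQ
    have hys : ContDiffAt ℝ 2 y r := contDiffAt_snd.comp r hTQ
    have hev : ∀ᶠ t in 𝓝 r, (Q t, t) ∈ S.target :=
      (hQ.continuousAt.prodMk continuousAt_id).eventually (S.open_target.mem_nhds hsrc)
    have hxy : (x r, y r) ∈ U := hsymm _ hsrc
    rw [hN.2.2.2.2 _ _ (hUE hxy)]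
    exact (hP _ _ hxy).transform hU hu hv hxy hxs hys
      (hev.mono fun t ht => congrArg Prod.fst (hleft _ ht))
      (hev.mono fun t ht => congrArg Prod.snd (hleft _ ht)) hx0

end SecondOrderODE

/-! ### Linear and quadratic normal forms. -/

namespace SecondOrderODE

/-- It suffices to deduce `P` from the vanishing of the invariants on some open set, and to
linearize the equation if `P` holds. -/
theorem LinearizableIff.of {E : SecondOrderODE} {N : CubicForm} (hN : E.HasCubicForm N) {P : Prop}
    (h₁ : ∀ V : Set (ℝ × ℝ), IsOpen V → V.Nonempty → V ⊆ E.dom →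
      (∀ z w, (z, w) ∈ V → N.Psi₁ z w = 0 ∧ N.Psi₂ z w = 0) → P)
    (h₂ : P → ∀ p ∈ E.dom, E.LinearizableAt p) : E.LinearizableIff P := by
  refine ⟨⟨N, hN, fun V hV hne hVE => ⟨h₁ V hV hne hVE, fun hP z w h => ?_⟩⟩,
    fun p hp => ⟨fun h => ?_, fun hP => h₂ hP p hp⟩⟩
  -- Under `P` the invariants need not be computed: they vanish because the equation is linearizable
  -- near each point.
  · obtain ⟨_, -, hV, -, hpsi⟩ := (h₂ hP _ (hVE h)).psi_eq_zero hN
    exact hpsi z w hV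
  · obtain ⟨V, hV, hpV, hVE, hpsi⟩ := h.psi_eq_zero hN
    exact h₁ V hV ⟨p, hpV⟩ hVE hpsi

/-- Up to a factor that depends on `z` only, the equation is the linear equation
`w'' + γ w' + δ₁ w + δ₀ = 0`. -/
structure LinearForm (E : SecondOrderODE) where
  Z : Set ℝ
  isOpen_Z : IsOpen Z
  (g γ δ₀ δ₁ : ℝ → ℝ)
  mem_dom : ∀ z w, (z, w) ∈ E.dom ↔ z ∈ Z
  g_ne : ∀ z ∈ Z, g z ≠ 0
  lhs_eq : ∀ z ∈ Z, ∀ w w₁ w₂,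
    E.lhs z w w₁ w₂ = g z * (w₂ + γ z * w₁ + δ₁ z * w + δ₀ z)
  smooth_γ : ∀ z ∈ Z, ContDiffAt ℝ ∞ γ z
  smooth_δ₀ : ∀ z ∈ Z, ContDiffAt ℝ ∞ δ₀ z
  smooth_δ₁ : ∀ z ∈ Z, ContDiffAt ℝ ∞ δ₁ z

/-- A linear equation is linearizable. -/
theorem LinearForm.linearizableIff {E : SecondOrderODE} (F : E.LinearForm) {P : Prop} (hP : P) :
    E.LinearizableIff P := by
  have hdom : E.dom = {x | x.1 ∈ F.Z} := by ext ⟨z, w⟩; exact F.mem_dom z w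
  have hopen : IsOpen E.dom := hdom ▸ F.isOpen_Z.preimage continuous_fst
  have hs {f : ℝ → ℝ} (hf : ∀ z ∈ F.Z, ContDiffAt ℝ ∞ f z) : SmoothOn₂ E.dom (fun z _ => f z) :=
    SmoothOn₂.fst.comp hopen fun z w h => hf z ((F.mem_dom z w).1 h)
  have hN : E.HasCubicForm
      ⟨fun _ _ => 0, fun _ _ => 0, fun z _ => F.γ z, fun z w => F.δ₁ z * w + F.δ₀ z⟩ := by
    refine ⟨contDiffOn_const, contDiffOn_const, hs F.smooth_γ,
      ((hs F.smooth_δ₁).mul .snd).add (hs F.smooth_δ₀), fun z w h w₁ w₂ => ?_⟩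
    have hz := (F.mem_dom z w).1 h
    rw [F.lhs_eq z hz, mul_eq_zero, or_iff_right (F.g_ne z hz)]
    refine Eq.congr_left ?_
    ring
  refine LinearizableIff.of hN (fun _ _ _ _ _ => hP) fun _ p hp => ?_
  refine linearizableAt_of_isPullbackAt hN hopen subset_rfl (u := fun _ w => w) (v := fun z _ => z)
    .snd .fst (a := F.γ) (b := F.δ₁) (c := F.δ₀) (fun z w h => ?_) (fun z w h => ?_) hp
  · have hz := (F.mem_dom z w).1 h
    exact ⟨F.smooth_γ z hz, F.smooth_δ₁ z hz, F.smooth_δ₀ z hz⟩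
  · have e₁ : pz (fun z _ => z) = fun _ _ => 1 := by ext; simp [pz]
    have e₂ : pw (fun _ w => w) = fun _ _ => 1 := by ext; simp [pw]
    have e₃ : pz (fun _ w => w) = fun _ _ => 0 := by ext; simp [pz]
    have e₄ : pw (fun z _ => z) = fun _ _ => 0 := by ext; simp [pw]
    have e₅ (k : ℝ) : pz (fun _ _ => k) = fun _ _ => 0 := by ext; simp [pz]
    have e₆ (k : ℝ) : pw (fun _ _ => k) = fun _ _ => 0 := by ext; simp [pw]
    constructor <;> simp [e₁, e₂, e₃, e₄, e₅, e₆]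

/-- Up to a factor that depends on `z` only, the equation is
`W w'' + w'^2 + (γ₁ W + γ₀) w' + δ₂ W^2 + δ₁ W + δ₀ = 0` with `W = w + φ`. -/
structure QuadraticForm (E : SecondOrderODE) where
  Z : Set ℝ
  isOpen_Z : IsOpen Z
  (g φ φ₁ φ₂ γ₀ γ₀' γ₁ δ₀ δ₁ δ₂ : ℝ → ℝ)
  mem_dom : ∀ z w, (z, w) ∈ E.dom ↔ z ∈ Z ∧ w + φ z ≠ 0
  g_ne : ∀ z ∈ Z, g z ≠ 0
  lhs_eq : ∀ z ∈ Z, ∀ w w₁ w₂,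
    E.lhs z w w₁ w₂ = g z * ((w + φ z) * w₂ + w₁ ^ 2 + (γ₁ z * (w + φ z) + γ₀ z) * w₁
      + (δ₂ z * (w + φ z) ^ 2 + δ₁ z * (w + φ z) + δ₀ z))
  hasDerivAt_φ : ∀ z ∈ Z, HasDerivAt φ (φ₁ z) z
  hasDerivAt_φ₁ : ∀ z ∈ Z, HasDerivAt φ₁ (φ₂ z) z
  hasDerivAt_γ₀ : ∀ z ∈ Z, HasDerivAt γ₀ (γ₀' z) z
  smooth_φ : ∀ z ∈ Z, ContDiffAt ℝ ∞ φ z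
  smooth_φ₁ : ∀ z ∈ Z, ContDiffAt ℝ ∞ φ₁ z
  smooth_γ₀ : ∀ z ∈ Z, ContDiffAt ℝ ∞ γ₀ z
  smooth_γ₁ : ∀ z ∈ Z, ContDiffAt ℝ ∞ γ₁ z
  smooth_δ₀ : ∀ z ∈ Z, ContDiffAt ℝ ∞ δ₀ z
  smooth_δ₁ : ∀ z ∈ Z, ContDiffAt ℝ ∞ δ₁ z
  smooth_δ₂ : ∀ z ∈ Z, ContDiffAt ℝ ∞ δ₂ z

namespace QuadraticForm

variable {E : SecondOrderODE}

/-- The cubic form of the equation. -/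
noncomputable def cubic (F : E.QuadraticForm) : CubicForm where
  A _ _ := 0
  B z w := 1 / (w + F.φ z)
  C z w := F.γ₁ z + F.γ₀ z / (w + F.φ z)
  D z w := F.δ₂ z * (w + F.φ z) + F.δ₁ z + F.δ₀ z / (w + F.φ z)

theorem isOpen_dom (F : E.QuadraticForm) : IsOpen E.dom := by
  have h : E.dom = {x | x.1 ∈ F.Z ∧ x.2 + F.φ x.1 ≠ 0} := by ext ⟨z, w⟩; exact F.mem_dom z w
  rw [h]
  have hc : ContinuousOn (fun x : ℝ × ℝ => x.2 + F.φ x.1) (Prod.fst ⁻¹' F.Z) := fun x hx =>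
    (continuousAt_snd.add ((F.smooth_φ _ hx).continuousAt.comp
      continuousAt_fst)).continuousWithinAt
  exact hc.isOpen_inter_preimage (F.isOpen_Z.preimage continuous_fst) isOpen_ne

theorem smooth (F : E.QuadraticForm) {f : ℝ → ℝ} (hf : ∀ z ∈ F.Z, ContDiffAt ℝ ∞ f z) :
    SmoothOn₂ E.dom (fun z _ => f z) :=
  SmoothOn₂.fst.comp F.isOpen_dom fun z w h => hf z ((F.mem_dom z w).1 h).1

theorem smooth_W (F : E.QuadraticForm) : SmoothOn₂ E.dom (fun z w => w + F.φ z) :=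
  SmoothOn₂.snd.add (F.smooth F.smooth_φ)

theorem hasCubicForm (F : E.QuadraticForm) : E.HasCubicForm F.cubic := by
  have h0 : ∀ z w, (z, w) ∈ E.dom → w + F.φ z ≠ 0 := fun z w h => ((F.mem_dom z w).1 h).2
  refine ⟨contDiffOn_const, (SmoothOn₂.const 1).div F.smooth_W h0,
    (F.smooth F.smooth_γ₁).add ((F.smooth F.smooth_γ₀).div F.smooth_W h0),
    (((F.smooth F.smooth_δ₂).mul F.smooth_W).add (F.smooth F.smooth_δ₁)).add
      ((F.smooth F.smooth_δ₀).div F.smooth_W h0), fun z w h w₁ w₂ => ?_⟩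
  obtain ⟨hz, hW⟩ := (F.mem_dom z w).1 h
  rw [F.lhs_eq z hz, mul_eq_zero, or_iff_right (F.g_ne z hz)]
  simp only [cubic]
  conv_rhs => rw [← or_iff_right (b := _ = (0 : ℝ)) hW, ← mul_eq_zero]
  refine Eq.congr_left ?_
  field_simp
  ring

/-- `δ₀` and `δ₂` drop out. Where `γ₀ = 2φ'` on an open set, the first invariant vanishes and the
second reduces to `3 (φ'' + γ₁ φ' - δ₁) / W²`, so the obstructions are exactly the two conditions of
`linearizableAt`. -/
theorem psi (F : E.QuadraticForm) {z w : ℝ} (h : (z, w) ∈ E.dom) :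
    F.cubic.Psi₁ z w = 3 * (F.γ₀ z - 2 * F.φ₁ z) / (w + F.φ z) ^ 3 ∧
    F.cubic.Psi₂ z w = (2 * F.γ₀' z - F.φ₂ z - 3 * F.δ₁ z + 2 * F.γ₀ z * F.γ₁ z
        - F.γ₁ z * F.φ₁ z) / (w + F.φ z) ^ 2
      + (2 * F.γ₀ z - F.φ₁ z) * (F.γ₀ z - 2 * F.φ₁ z) / (w + F.φ z) ^ 3 := by
  have hU := F.isOpen_dom
  have hWz (z w) (h : (z, w) ∈ E.dom) : HasDerivAt (fun t => w + F.φ t) (F.φ₁ z) z :=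
    (F.hasDerivAt_φ z ((F.mem_dom z w).1 h).1).const_add w
  have hWw (z w) : HasDerivAt (fun t => t + F.φ z) 1 w := (hasDerivAt_id w).add_const _
  have h0 (z w) (h : (z, w) ∈ E.dom) : w + F.φ z ≠ 0 := ((F.mem_dom z w).1 h).2
  have hγ₀ (z w) (h : (z, w) ∈ E.dom) := F.hasDerivAt_γ₀ z ((F.mem_dom z w).1 h).1
  have hφ₁ (z w) (h : (z, w) ∈ E.dom) := F.hasDerivAt_φ₁ z ((F.mem_dom z w).1 h).1
  have hγ₁ (z w) (h : (z, w) ∈ E.dom) : HasDerivAt F.γ₁ (deriv F.γ₁ z) z :=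
    ((F.smooth_γ₁ z ((F.mem_dom z w).1 h).1).differentiableAt (by simp)).hasDerivAt
  have hB : ∀ z w, F.cubic.B z w = 1 / (w + F.φ z) := fun _ _ => rfl
  have hC : ∀ z w, F.cubic.C z w = F.γ₁ z + F.γ₀ z / (w + F.φ z) := fun _ _ => rfl
  have hD : ∀ z w, F.cubic.D z w
    = F.δ₂ z * (w + F.φ z) + F.δ₁ z + F.δ₀ z / (w + F.φ z) := fun _ _ => rfl
  have dBz (z w) (h : (z, w) ∈ E.dom) :
      HasDerivAt (fun t => F.cubic.B t w) (-F.φ₁ z / (w + F.φ z) ^ 2) z :=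
    ((hasDerivAt_const z 1).fun_div (hWz z w h) (h0 z w h)).congr_deriv (by simp)
  have dBw (z w) (h : (z, w) ∈ E.dom) :
      HasDerivAt (fun t => F.cubic.B z t) (-1 / (w + F.φ z) ^ 2) w :=
    ((hasDerivAt_const w 1).fun_div (hWw z w) (h0 z w h)).congr_deriv (by simp)
  have dCz (z w) (h : (z, w) ∈ E.dom) : HasDerivAt (fun t => F.cubic.C t w)
      (deriv F.γ₁ z + (F.γ₀' z * (w + F.φ z) - F.γ₀ z * F.φ₁ z) / (w + F.φ z) ^ 2) z :=
    (hγ₁ z w h).add ((hγ₀ z w h).fun_div (hWz z w h) (h0 z w h))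
  have dCw (z w) (h : (z, w) ∈ E.dom) : HasDerivAt (fun t => F.cubic.C z t)
      (-F.γ₀ z / (w + F.φ z) ^ 2) w :=
    (((hasDerivAt_const w (F.γ₀ z)).fun_div (hWw z w) (h0 z w h)).const_add _).congr_deriv
      (by simp)
  have dDw (z w) (h : (z, w) ∈ E.dom) : HasDerivAt (fun t => F.cubic.D z t)
      (F.δ₂ z + -F.δ₀ z / (w + F.φ z) ^ 2) w :=
    ((((hWw z w).const_mul (F.δ₂ z)).add_const (F.δ₁ z)).add
      ((hasDerivAt_const w (F.δ₀ z)).fun_div (hWw z w) (h0 z w h))).congr_deriv (by simp)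
  have hW := h0 z w h
  have hW2 : (w + F.φ z) ^ 2 ≠ 0 := pow_ne_zero 2 hW
  have dW2z := (hWz z w h).fun_pow 2
  have dW2w := (hWw z w).fun_pow 2
  have e₁ : pw (pz F.cubic.B) z w = _ := (pw_congr hU (fun z w h => (dBz z w h).deriv) h).trans
    ((hasDerivAt_const w (-F.φ₁ z)).fun_div dW2w hW2).deriv
  have e₂ : pw (pw F.cubic.C) z w = _ := (pw_congr hU (fun z w h => (dCw z w h).deriv) h).trans
    ((hasDerivAt_const w (-F.γ₀ z)).fun_div dW2w hW2).deriv
  have e₃ : pz (fun z w => F.cubic.B z w ^ 2) z w = _ := ((dBz z w h).fun_pow 2).deriv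
  have e₄ : pw F.cubic.C z w = _ := (dCw z w h).deriv
  have e₅ : pw (pw F.cubic.D) z w = _ := (pw_congr hU (fun z w h => (dDw z w h).deriv) h).trans
    (((hasDerivAt_const w (-F.δ₀ z)).fun_div dW2w hW2).const_add _).deriv
  have e₆ : pw (pz F.cubic.C) z w = _ := (pw_congr hU (fun z w h => (dCz z w h).deriv) h).trans
    (((((hWw z w).const_mul (F.γ₀' z)).sub_const (F.γ₀ z * F.φ₁ z)).fun_div dW2w
      hW2).const_add _).deriv
  have e₇ : pz (pz F.cubic.B) z w = _ := (pz_congr hU (fun z w h => (dBz z w h).deriv) h).trans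
    ((hφ₁ z w h).fun_neg.fun_div dW2z hW2).deriv
  have e₈ : pw (fun z w => F.cubic.D z w * F.cubic.B z w) z w = _ :=
    ((dDw z w h).fun_mul (dBw z w h)).deriv
  have e₉ : pw (fun z w => F.cubic.C z w ^ 2) z w = _ := ((dCw z w h).fun_pow 2).deriv
  have e₁₀ : pz F.cubic.B z w = _ := (dBz z w h).deriv
  have hA : ∀ z w, F.cubic.A z w = 0 := fun _ _ => rfl
  simp only [CubicForm.Psi₁, CubicForm.Psi₂, e₁, e₂, e₃, e₄, e₅, e₆, e₇, e₈, e₉, e₁₀]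
  simp only [hA, hB, hC, hD, mul_zero, pz, pw, deriv_const]
  push_cast
  constructor
  · field_simp
    ring
  · field_simp
    ring

/-- For `Q = W²` one has `Q''/2 = W w'' + w'^2 + 2φ' w' + φ'' W + φ'^2` and `Q'/2 = W (w' + φ')`.
The hypotheses cancel the terms in `w'` alone and in `W` alone, which leaves `Q'' + γ₁ Q' + 2δ₂ Q +
2(δ₀ - φ'^2) = 0`. -/
theorem linearizableAt (F : E.QuadraticForm) (h₀ : ∀ z ∈ F.Z, F.γ₀ z = 2 * F.φ₁ z)
    (h₁ : ∀ z ∈ F.Z, F.δ₁ z = F.φ₂ z + F.γ₁ z * F.φ₁ z) {p : ℝ × ℝ} (hp : p ∈ E.dom) :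
    E.LinearizableAt p := by
  have hU := F.isOpen_dom
  refine linearizableAt_of_isPullbackAt F.hasCubicForm hU subset_rfl
    (u := fun z w => (w + F.φ z) ^ 2) (v := fun z _ => z) (F.smooth_W.pow 2) .fst
    (a := F.γ₁) (b := fun z => 2 * F.δ₂ z) (c := fun z => 2 * (F.δ₀ z - F.φ₁ z ^ 2))
    (fun z w h => ?_) (fun z w h => ?_) hp
  · have hz := ((F.mem_dom z w).1 h).1
    exact ⟨F.smooth_γ₁ z hz, contDiffAt_const.mul (F.smooth_δ₂ z hz),
      contDiffAt_const.mul ((F.smooth_δ₀ z hz).sub ((F.smooth_φ₁ z hz).pow 2))⟩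
  · obtain ⟨hz, hW⟩ := (F.mem_dom z w).1 h
    have hWz (z w) (h : (z, w) ∈ E.dom) : HasDerivAt (fun t => w + F.φ t) (F.φ₁ z) z :=
      (F.hasDerivAt_φ z ((F.mem_dom z w).1 h).1).const_add w
    have hWw (z w) : HasDerivAt (fun t => t + F.φ z) 1 w := (hasDerivAt_id w).add_const _
    have duz (z w) (h : (z, w) ∈ E.dom) : pz (fun z w => (w + F.φ z) ^ 2) z w
        = 2 * (w + F.φ z) * F.φ₁ z := by
      refine ((hWz z w h).fun_pow 2).deriv.trans (by simp)
    have duw (z w) : pw (fun z w => (w + F.φ z) ^ 2) z w = 2 * (w + F.φ z) := by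
      refine ((hWw z w).fun_pow 2).deriv.trans (by simp)
    have e₁ : pz (pz (fun z w => (w + F.φ z) ^ 2)) z w = _ := (pz_congr hU duz h).trans
      (((hWz z w h).const_mul 2).fun_mul (F.hasDerivAt_φ₁ z hz)).deriv
    have e₂ : pw (pz (fun z w => (w + F.φ z) ^ 2)) z w = _ := (pw_congr hU duz h).trans
      (((hWw z w).const_mul 2).mul_const (F.φ₁ z)).deriv
    have e₃ : pw (pw (fun z w => (w + F.φ z) ^ 2)) z w = _ :=
      (pw_congr hU (fun z w _ => duw z w) h).trans ((hWw z w).const_mul 2).deriv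
    have e₄ : pz (fun z _ => z) = fun _ _ => 1 := by ext; simp [pz]
    have e₅ : pw (fun z _ => z) = fun _ _ => 0 := by ext; simp [pw]
    have e₆ : pz (fun _ _ => 1) = fun _ _ => 0 := by ext; simp [pz]
    have e₇ (k : ℝ) : pw (fun _ _ => k) = fun _ _ => 0 := by ext; simp [pw]
    constructor <;> simp only [e₁, e₂, e₃, e₄, e₅, e₆, e₇, duz z w h, duw, cubic]
    · simpa using hW
    · ring
    · field_simp
      ring
    · rw [h₀ z hz]
      field_simp
      ring
    · rw [h₁ z hz]
      field_simp
      ring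

/-- The vanishing of the first invariant on a nonempty open set. -/
theorem eventually_of_psi₁ (F : E.QuadraticForm) {V : Set (ℝ × ℝ)} (hV : IsOpen V) (hne : V.Nonempty) (hVE : V ⊆ E.dom)
    (h : ∀ z w, (z, w) ∈ V → F.cubic.Psi₁ z w = 0) :
    ∃ z₀ ∈ F.Z, ∀ᶠ z in 𝓝 z₀, z ∈ F.Z ∧ F.γ₀ z = 2 * F.φ₁ z := by
  obtain ⟨⟨z₀, w₀⟩, h0⟩ := hne
  refine ⟨z₀, ((F.mem_dom z₀ w₀).1 (hVE h0)).1, ?_⟩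
  filter_upwards [eventually_mem_fst hV h0] with z hz
  obtain ⟨hzZ, hW⟩ := (F.mem_dom z w₀).1 (hVE hz)
  refine ⟨hzZ, ?_⟩
  have h1 := h z w₀ hz
  rw [(F.psi (hVE hz)).1, div_eq_zero_iff, or_iff_left (pow_ne_zero 3 hW)] at h1
  linarith

/-- The vanishing of the second invariant on a nonempty open set. -/
theorem eq_of_psi₂ (F : E.QuadraticForm) {V : Set (ℝ × ℝ)} (hV : IsOpen V) (hne : V.Nonempty)
    (hVE : V ⊆ E.dom) (h : ∀ z w, (z, w) ∈ V → F.cubic.Psi₂ z w = 0) :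
    ∃ z ∈ F.Z, 2 * F.γ₀' z - F.φ₂ z - 3 * F.δ₁ z + 2 * F.γ₀ z * F.γ₁ z - F.γ₁ z * F.φ₁ z = 0 ∧
      (2 * F.γ₀ z - F.φ₁ z) * (F.γ₀ z - 2 * F.φ₁ z) = 0 := by
  obtain ⟨⟨z, w⟩, h0⟩ := hne
  refine ⟨z, ((F.mem_dom z w).1 (hVE h0)).1, ?_⟩
  -- For fixed `z`, the product of `W³` and the second invariant is affine in `w`; its values at two
  -- points of the vertical slice of `V` make both coefficients vanish.
  have key : ∀ t, (z, t) ∈ V →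
      (2 * F.γ₀' z - F.φ₂ z - 3 * F.δ₁ z + 2 * F.γ₀ z * F.γ₁ z - F.γ₁ z * F.φ₁ z)
        * (t + F.φ z) + (2 * F.γ₀ z - F.φ₁ z) * (F.γ₀ z - 2 * F.φ₁ z) = 0 := fun t ht => by
    have hW := ((F.mem_dom z t).1 (hVE ht)).2
    have h1 := h z t ht
    rw [(F.psi (hVE ht)).2] at h1
    field_simp at h1
    linear_combination h1
  have hev : ∀ᶠ t in 𝓝[≠] w, (z, t) ∈ V :=
    (eventually_mem_snd hV h0).filter_mono nhdsWithin_le_nhds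
  obtain ⟨t, ht, htw⟩ := (hev.and self_mem_nhdsWithin).exists
  have e₁ := key w h0
  have e₂ := key t ht
  have e₃ := mul_left_cancel₀ (sub_ne_zero.2 htw) (b := 2 * F.γ₀' z - F.φ₂ z - 3 * F.δ₁ z
    + 2 * F.γ₀ z * F.γ₁ z - F.γ₁ z * F.φ₁ z) (c := 0) (by linear_combination e₂ - e₁)
  exact ⟨e₃, by linear_combination e₁ - (w + F.φ z) * e₃⟩

theorem linearizableIff (F : E.QuadraticForm) {P : Prop} (h₁ : ∀ V : Set (ℝ × ℝ), IsOpen V → V.Nonempty → V ⊆ E.dom →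
      (∀ z w, (z, w) ∈ V → F.cubic.Psi₁ z w = 0 ∧ F.cubic.Psi₂ z w = 0) → P)
    (h₂ : P → ∀ z ∈ F.Z, F.γ₀ z = 2 * F.φ₁ z ∧ F.δ₁ z = F.φ₂ z + F.γ₁ z * F.φ₁ z) :
    E.LinearizableIff P :=
  LinearizableIff.of F.hasCubicForm h₁ fun hP _ hp =>
    F.linearizableAt (fun z hz => (h₂ hP z hz).1) (fun z hz => (h₂ hP z hz).2) hp

end QuadraticForm

end SecondOrderODE

/-! ### The equations with polynomial coefficients. -/

theorem hasDerivAt_const_div_pow (c : ℝ) (n : ℕ) {z : ℝ} (hz : z ≠ 0) :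
    HasDerivAt (fun z => c / z ^ n) (-(n * c) / z ^ (n + 1)) z := by
  refine ((hasDerivAt_const z c).fun_div (hasDerivAt_pow n z) (pow_ne_zero n hz)).congr_deriv ?_
  cases n with
  | zero => simp
  | succ n =>
    field_simp
    push_cast
    ring

theorem contDiffAt_const_div_pow (c : ℝ) (n : ℕ) {z : ℝ} (hz : z ≠ 0) :
    ContDiffAt ℝ ∞ (fun z => c / z ^ n) z :=
  contDiffAt_const.div (contDiffAt_id.pow n) (pow_ne_zero n hz)

/-- The exponent `q` is a separate variable so that the derivative can be stated with the exponent
in the form used by the normal forms. -/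
theorem hasDerivAt_const_mul_rpow (c : ℝ) {p q z : ℝ} (hq : q = p - 1) (hz : 0 < z) :
    HasDerivAt (fun z : ℝ => c * z ^ p) (c * p * z ^ q) z := by
  subst hq
  exact ((Real.hasDerivAt_rpow_const (Or.inl hz.ne')).const_mul c).congr_deriv (by ring)

theorem contDiffAt_const_mul_rpow (c p : ℝ) {z : ℝ} (hz : 0 < z) :
    ContDiffAt ℝ ∞ (fun z : ℝ => c * z ^ p) z :=
  contDiffAt_const.mul (Real.contDiffAt_rpow_const_of_ne hz.ne')

namespace SecondOrderODE

/-- The normal form of `red21`. -/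
noncomputable def red21Form : red21.QuadraticForm where
  Z := {z | z ≠ 0}
  isOpen_Z := isOpen_ne
  g z := -z ^ 2
  φ z := 4 / z ^ 1
  φ₁ z := -4 / z ^ 2
  φ₂ z := 8 / z ^ 3
  γ₀ z := 10 / z ^ 2
  γ₀' z := -20 / z ^ 3
  γ₁ z := -2 / z ^ 1
  δ₀ z := 16 / z ^ 4
  δ₁ z := -8 / z ^ 3
  δ₂ z := 1 / z ^ 2
  mem_dom z w := by
    by_cases hz : z = 0
    · simp [red21, hz]
    · rw [Set.mem_ofPred_eq, and_iff_right hz, show w + 4 / z ^ 1 = (4 * z + w * z ^ 2) / z ^ 2 by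
        field_simp; ring]
      simp [red21, hz]
  g_ne z hz := neg_ne_zero.2 (pow_ne_zero 2 hz)
  lhs_eq z hz w w₁ w₂ := by
    have hz : z ≠ 0 := hz
    simp only [red21]
    field_simp
    ring
  hasDerivAt_φ z hz := (hasDerivAt_const_div_pow 4 1 hz).congr_deriv (by norm_num)
  hasDerivAt_φ₁ z hz := (hasDerivAt_const_div_pow (-4) 2 hz).congr_deriv (by norm_num)
  hasDerivAt_γ₀ z hz := (hasDerivAt_const_div_pow 10 2 hz).congr_deriv (by norm_num)
  smooth_φ z hz := contDiffAt_const_div_pow _ _ hz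
  smooth_φ₁ z hz := contDiffAt_const_div_pow _ _ hz
  smooth_γ₀ z hz := contDiffAt_const_div_pow _ _ hz
  smooth_γ₁ z hz := contDiffAt_const_div_pow _ _ hz
  smooth_δ₀ z hz := contDiffAt_const_div_pow _ _ hz
  smooth_δ₁ z hz := contDiffAt_const_div_pow _ _ hz
  smooth_δ₂ z hz := contDiffAt_const_div_pow _ _ hz

theorem red21_linearizableIff : red21.LinearizableIff False :=
  red21Form.linearizableIff (fun V hV hne hVE h => by
    obtain ⟨z, hz, hev⟩ := red21Form.eventually_of_psi₁ hV hne hVE fun z w h' => (h z w h').1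
    have hz : z ≠ 0 := hz
    have h1 := hev.self_of_nhds.2
    -- The condition `γ₀ = 2φ'` reads `10 / z² = -8 / z²`.
    simp only [red21Form] at h1
    field_simp at h1
    norm_num at h1) False.elim

theorem red21_psi {z w : ℝ} (h : (z, w) ∈ red21.dom) :
    red21Form.cubic.Psi₁ z w = 54 * z / (4 + w * z) ^ 3 ∧
      red21Form.cubic.Psi₂ z w = -(72 * (-2 + w * z) / (z * (4 + w * z) ^ 3)) := by
  have hz : z ≠ 0 := ((red21Form.mem_dom z w).1 h).1
  have hW : 4 + w * z ≠ 0 := fun h0 => h (by linear_combination z * h0)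
  have hφ : w + red21Form.φ z = (4 + w * z) / z := by
    simp only [red21Form]
    field_simp
    ring
  rw [(red21Form.psi h).1, (red21Form.psi h).2, hφ]
  simp only [red21Form]
  constructor
  · field_simp
    ring
  · field_simp
    ring

/-- The normal form of `red22` if `c₂ ≠ 0`. -/
noncomputable def red22Form (l k₀ k₁ c₁ c₂ c₃ : ℝ) (hc : c₂ ≠ 0) :
    (red22 l k₀ k₁ c₁ c₂ c₃).QuadraticForm where
  Z := {z | z ≠ 0}
  isOpen_Z := isOpen_ne
  g z := -c₂ ^ 2 * z
  φ z := c₁ ^ 2 / c₂ ^ 2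
    + 2 * (2 * c₁ * (k₀ - c₃ * k₁) + c₂ ^ 2 * k₁) / c₂ ^ 2 * z ^ 2
    + 4 * (k₀ - c₃ * k₁) ^ 2 / c₂ ^ 2 * z ^ 4
  φ₁ z := 4 * (2 * c₁ * (k₀ - c₃ * k₁) + c₂ ^ 2 * k₁) / c₂ ^ 2 * z
    + 16 * (k₀ - c₃ * k₁) ^ 2 / c₂ ^ 2 * z ^ 3
  φ₂ z := 4 * (2 * c₁ * (k₀ - c₃ * k₁) + c₂ ^ 2 * k₁) / c₂ ^ 2
    + 48 * (k₀ - c₃ * k₁) ^ 2 / c₂ ^ 2 * z ^ 2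
  γ₀ z := -(2 * c₁ * (k₀ - c₃ * k₁) + c₂ ^ 2 * k₁) / c₂ ^ 2 * z
    - 4 * (k₀ - c₃ * k₁) ^ 2 / c₂ ^ 2 * z ^ 3
  γ₀' z := -(2 * c₁ * (k₀ - c₃ * k₁) + c₂ ^ 2 * k₁) / c₂ ^ 2
    - 12 * (k₀ - c₃ * k₁) ^ 2 / c₂ ^ 2 * z ^ 2
  γ₁ z := -1 / z ^ 1
  δ₀ z := -(8 * z ^ 2 * (k₀ - c₃ * k₁) ^ 2 * (c₁ ^ 2 / c₂ ^ 2
    + 2 * (2 * c₁ * (k₀ - c₃ * k₁) + c₂ ^ 2 * k₁) / c₂ ^ 2 * z ^ 2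
    + 4 * (k₀ - c₃ * k₁) ^ 2 / c₂ ^ 2 * z ^ 4) + 2 * z ^ 2 * k₁ * l) / c₂ ^ 2
  δ₁ z := 8 * (k₀ - c₃ * k₁) ^ 2 / c₂ ^ 2 * z ^ 2
  δ₂ _ := 0
  mem_dom z w := by
    rw [Set.mem_ofPred_eq, ← mul_ne_zero_iff, ← mul_ne_zero_iff_left (pow_ne_zero 2 hc),
      ← neg_ne_zero]
    refine Iff.of_eq (congrArg (· ≠ 0) ?_)
    field_simp
    ring
  g_ne z hz := mul_ne_zero (neg_ne_zero.2 (pow_ne_zero 2 hc)) hz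
  lhs_eq z hz w w₁ w₂ := by
    have hz : z ≠ 0 := hz
    simp only [red22]
    field_simp
    ring
  hasDerivAt_φ z _ := ((((hasDerivAt_pow 2 z).const_mul _).const_add _).add
    ((hasDerivAt_pow 4 z).const_mul _)).congr_deriv (by push_cast; ring)
  hasDerivAt_φ₁ z _ := (((hasDerivAt_id z).const_mul _).add
    ((hasDerivAt_pow 3 z).const_mul _)).congr_deriv (by push_cast; ring)
  hasDerivAt_γ₀ z _ := (((hasDerivAt_id z).const_mul _).sub
    ((hasDerivAt_pow 3 z).const_mul _)).congr_deriv (by push_cast; ring)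
  smooth_φ z _ := by fun_prop
  smooth_φ₁ z _ := by fun_prop
  smooth_γ₀ z _ := by fun_prop
  smooth_γ₁ z hz := contDiffAt_const_div_pow _ _ hz
  smooth_δ₀ z _ := by fun_prop
  smooth_δ₁ z _ := by fun_prop
  smooth_δ₂ z _ := contDiffAt_const

/-- `red22` is linear if `c₂ = 0`. -/
noncomputable def red22LinearForm (l k₀ k₁ c₁ c₃ : ℝ) :
    (red22 l k₀ k₁ c₁ 0 c₃).LinearForm where
  Z := {z | -z * (c₁ + 2 * z ^ 2 * (k₀ - c₃ * k₁)) ^ 2 ≠ 0}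
  isOpen_Z := isOpen_ne_fun (by fun_prop) continuous_const
  -- For `c₂ = 0` the coefficient of `w''` is `-z` times a perfect square.
  g z := -z * (c₁ + 2 * z ^ 2 * (k₀ - c₃ * k₁)) ^ 2
  γ z := (c₁ ^ 2 + 8 * z ^ 4 * (k₀ - c₃ * k₁) ^ 2 + 6 * z ^ 2 * c₁ * (k₀ - c₃ * k₁))
    / (-z * (c₁ + 2 * z ^ 2 * (k₀ - c₃ * k₁)) ^ 2)
  δ₀ z := 2 * z ^ 3 * k₁ * l / (-z * (c₁ + 2 * z ^ 2 * (k₀ - c₃ * k₁)) ^ 2)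
  δ₁ z := -8 * z ^ 3 * (k₀ - c₃ * k₁) ^ 2 / (-z * (c₁ + 2 * z ^ 2 * (k₀ - c₃ * k₁)) ^ 2)
  mem_dom z w := by
    refine Iff.of_eq (congrArg (· ≠ 0) ?_)
    simp only
    ring
  g_ne z hz := hz
  lhs_eq z hz w w₁ w₂ := by
    have hz : -z * (c₁ + 2 * z ^ 2 * (k₀ - c₃ * k₁)) ^ 2 ≠ 0 := hz
    rw [show ∀ G x y t : ℝ, G * (w₂ + x / G * w₁ + y / G * w + t / G)
      = G * w₂ + G * (x / G) * w₁ + G * (y / G) * w + G * (t / G) from fun G x y t => by ring,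
      mul_div_cancel₀ _ hz, mul_div_cancel₀ _ hz, mul_div_cancel₀ _ hz]
    simp only [red22]
    ring
  smooth_γ z hz := by
    have h : -z * (c₁ + 2 * z ^ 2 * (k₀ - c₃ * k₁)) ^ 2 ≠ 0 := hz
    fun_prop (disch := exact h)
  smooth_δ₀ z hz := by
    have h : -z * (c₁ + 2 * z ^ 2 * (k₀ - c₃ * k₁)) ^ 2 ≠ 0 := hz
    fun_prop (disch := exact h)
  smooth_δ₁ z hz := by
    have h : -z * (c₁ + 2 * z ^ 2 * (k₀ - c₃ * k₁)) ^ 2 ≠ 0 := hz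
    fun_prop (disch := exact h)

theorem red22_linearizableIff (l k₀ k₁ c₁ c₂ c₃ : ℝ) :
    (red22 l k₀ k₁ c₁ c₂ c₃).LinearizableIff (c₂ = 0 ∨ (k₀ = 0 ∧ k₁ = 0)) := by
  by_cases hc : c₂ = 0
  · subst hc
    exact (red22LinearForm l k₀ k₁ c₁ c₃).linearizableIff (Or.inl rfl)
  refine (red22Form l k₀ k₁ c₁ c₂ c₃ hc).linearizableIff (fun V hV hne hVE h => Or.inr ?_) ?_
  · obtain ⟨z₀, hz₀, hev⟩ :=
      (red22Form l k₀ k₁ c₁ c₂ c₃ hc).eventually_of_psi₁ hV hne hVE fun z w h' => (h z w h').1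
    have hz₀ : z₀ ≠ 0 := hz₀
    -- This is `γ₀ = 2φ'` divided by `-9 z / c₂²`. Holding on an interval, it may be differentiated:
    -- the derivative gives `k₀ = c₃ k₁`, and what is left is `c₂² k₁ = 0`.
    have key : ∀ᶠ z in 𝓝 z₀, 4 * (k₀ - c₃ * k₁) ^ 2 * z ^ 2
        + (2 * c₁ * (k₀ - c₃ * k₁) + c₂ ^ 2 * k₁) = 0 := by
      filter_upwards [hev] with z hz
      obtain ⟨hz0, hz⟩ := hz
      have hz0 : z ≠ 0 := hz0
      simp only [red22Form] at hz
      field_simp at hz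
      linear_combination -hz / 9
    have hd : HasDerivAt (fun z => 4 * (k₀ - c₃ * k₁) ^ 2 * z ^ 2
        + (2 * c₁ * (k₀ - c₃ * k₁) + c₂ ^ 2 * k₁)) (8 * (k₀ - c₃ * k₁) ^ 2 * z₀) z₀ :=
      (((hasDerivAt_pow 2 z₀).const_mul _).add_const _).congr_deriv (by push_cast; ring)
    have h0 := hd.unique ((hasDerivAt_const z₀ (0 : ℝ)).congr_of_eventuallyEq key)
    have hK : k₀ - c₃ * k₁ = 0 := by simpa [hz₀] using h0
    have h1 := key.self_of_nhds
    rw [hK] at h1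
    have hk₁ : k₁ = 0 := by simpa [hc] using h1
    exact ⟨by simpa [hk₁] using hK, hk₁⟩
  · rintro (h | ⟨rfl, rfl⟩) z -
    · exact absurd h hc
    · simp [red22Form]

/-- The normal form of `red27`. -/
noncomputable def red27Form (k₀ : ℝ) : (red27 k₀).QuadraticForm where
  Z := Set.univ
  isOpen_Z := isOpen_univ
  g _ := 1
  φ z := -k₀ * z
  φ₁ _ := -k₀
  φ₂ _ := 0
  γ₀ _ := k₀
  γ₀' _ := 0
  γ₁ _ := 0
  δ₀ _ := 0
  δ₁ _ := 0
  δ₂ _ := 0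
  mem_dom z w := by
    simp only [red27, Set.mem_ofPred_eq, Set.mem_univ, true_and]
    refine Iff.of_eq (congrArg (· ≠ 0) ?_)
    ring
  g_ne z _ := one_ne_zero
  lhs_eq z _ w w₁ w₂ := by
    simp only [red27]
    ring
  hasDerivAt_φ z _ := ((hasDerivAt_id z).const_mul _).congr_deriv (mul_one _)
  hasDerivAt_φ₁ z _ := hasDerivAt_const _ _
  hasDerivAt_γ₀ z _ := hasDerivAt_const _ _
  smooth_φ z _ := by fun_prop
  smooth_φ₁ z _ := contDiffAt_const
  smooth_γ₀ z _ := contDiffAt_const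
  smooth_γ₁ z _ := contDiffAt_const
  smooth_δ₀ z _ := contDiffAt_const
  smooth_δ₁ z _ := contDiffAt_const
  smooth_δ₂ z _ := contDiffAt_const

theorem red27_linearizableIff (k₀ : ℝ) : (red27 k₀).LinearizableIff (k₀ = 0) := by
  refine (red27Form k₀).linearizableIff (fun V hV hne hVE h => ?_) ?_
  · obtain ⟨z, -, hev⟩ :=
      (red27Form k₀).eventually_of_psi₁ hV hne hVE fun z w h' => (h z w h').1
    have h1 := hev.self_of_nhds.2
    -- The condition `γ₀ = 2φ'` reads `k₀ = -2 k₀`.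
    simp only [red27Form] at h1
    linarith
  · rintro rfl z -
    simp [red27Form]

/-- The equation is `w w'' + w'^2 = 0`, and its left-hand side is half of `(w²)''`. -/
theorem red27_zero_lhs {w : ℝ → ℝ} {z : ℝ} (hw : ContDiffAt ℝ 2 w z) :
    (red27 0).lhs z (w z) (deriv w z) (deriv (deriv w) z) = 0 ↔
      deriv (deriv (fun t => w t ^ 2)) z = 0 := by
  obtain ⟨h₁, h₂⟩ := hw.hasDerivAt_deriv_of_two
  have h₃ : deriv (fun t => w t ^ 2) =ᶠ[𝓝 z] fun t => 2 * w t * deriv w t := by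
    filter_upwards [h₁] with t ht
    rw [(ht.fun_pow 2).deriv]
    simp
  have h₄ := ((h₁.self_of_nhds.const_mul 2).fun_mul h₂).deriv
  rw [h₃.deriv_eq, h₄, show 2 * deriv w z * deriv w z + 2 * w z * deriv (deriv w) z
    = 2 * (red27 0).lhs z (w z) (deriv w z) (deriv (deriv w) z) by simp only [red27]; ring]
  simp

/-- The normal form of `red28b1`. -/
noncomputable def red28b1Form (c₁ : ℝ) : (red28b1 c₁).QuadraticForm where
  Z := {z | z ≠ 0}
  isOpen_Z := isOpen_ne
  g z := -z ^ 2
  φ z := 4 * c₁ ^ 2 * z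
  φ₁ _ := 4 * c₁ ^ 2
  φ₂ _ := 0
  γ₀ _ := 18 * c₁ ^ 2
  γ₀' _ := 0
  γ₁ z := -3 / z ^ 1
  δ₀ _ := 32 * c₁ ^ 4
  δ₁ z := -16 * c₁ ^ 2 / z ^ 1
  δ₂ z := 2 / z ^ 2
  mem_dom z w := by
    rw [Set.mem_ofPred_eq, ← pow_ne_zero_iff (two_ne_zero), ← mul_ne_zero_iff, ← neg_ne_zero]
    refine Iff.of_eq (congrArg (· ≠ 0) ?_)
    ring
  g_ne z hz := neg_ne_zero.2 (pow_ne_zero 2 hz)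
  lhs_eq z hz w w₁ w₂ := by
    have hz : z ≠ 0 := hz
    simp only [red28b1]
    field_simp
    ring
  hasDerivAt_φ z _ := ((hasDerivAt_id z).const_mul _).congr_deriv (mul_one _)
  hasDerivAt_φ₁ z _ := hasDerivAt_const _ _
  hasDerivAt_γ₀ z _ := hasDerivAt_const _ _
  smooth_φ z _ := by fun_prop
  smooth_φ₁ z _ := contDiffAt_const
  smooth_γ₀ z _ := contDiffAt_const
  smooth_γ₁ z hz := contDiffAt_const_div_pow _ _ hz
  smooth_δ₀ z _ := contDiffAt_const
  smooth_δ₁ z hz := contDiffAt_const_div_pow _ _ hz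
  smooth_δ₂ z hz := contDiffAt_const_div_pow _ _ hz

theorem red28b1_linearizableIff (c₁ : ℝ) : (red28b1 c₁).LinearizableIff (c₁ = 0) := by
  refine (red28b1Form c₁).linearizableIff (fun V hV hne hVE h => ?_) ?_
  · obtain ⟨z, -, hev⟩ :=
      (red28b1Form c₁).eventually_of_psi₁ hV hne hVE fun z w h' => (h z w h').1
    have h1 := hev.self_of_nhds.2
    -- The condition `γ₀ = 2φ'` reads `18 c₁² = 8 c₁²`.
    simp only [red28b1Form] at h1
    exact pow_eq_zero_iff two_ne_zero |>.1 (by linarith)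
  · rintro rfl z -
    simp [red28b1Form]

/-- The normal form of `red28b2` if `c₂ ≠ 0`. -/
noncomputable def red28b2Form (c₂ : ℝ) (hc : c₂ ≠ 0) : (red28b2 c₂).QuadraticForm where
  Z := {z | z ≠ 0}
  isOpen_Z := isOpen_ne
  g z := -c₂ ^ 2 * z ^ 2
  φ _ := 1 / c₂ ^ 2
  φ₁ _ := 0
  φ₂ _ := 0
  γ₀ z := -7 / c₂ ^ 2 / z ^ 1
  γ₀' z := 7 / c₂ ^ 2 / z ^ 2
  γ₁ z := 8 / z ^ 1
  δ₀ z := 6 / c₂ ^ 4 / z ^ 2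
  δ₁ z := -12 / c₂ ^ 2 / z ^ 2
  δ₂ z := 6 / z ^ 2
  mem_dom z w := by
    rw [Set.mem_ofPred_eq, ← pow_ne_zero_iff (two_ne_zero), ← mul_ne_zero_iff,
      ← mul_ne_zero_iff_left (pow_ne_zero 2 hc)]
    refine Iff.of_eq (congrArg (· ≠ 0) ?_)
    field_simp
    ring
  g_ne z hz := mul_ne_zero (neg_ne_zero.2 (pow_ne_zero 2 hc)) (pow_ne_zero 2 hz)
  lhs_eq z hz w w₁ w₂ := by
    have hz : z ≠ 0 := hz
    simp only [red28b2]
    field_simp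
    ring
  hasDerivAt_φ z _ := hasDerivAt_const _ _
  hasDerivAt_φ₁ z _ := hasDerivAt_const _ _
  hasDerivAt_γ₀ z hz := (hasDerivAt_const_div_pow _ 1 hz).congr_deriv (by push_cast; ring)
  smooth_φ z _ := contDiffAt_const
  smooth_φ₁ z _ := contDiffAt_const
  smooth_γ₀ z hz := contDiffAt_const_div_pow _ _ hz
  smooth_γ₁ z hz := contDiffAt_const_div_pow _ _ hz
  smooth_δ₀ z hz := contDiffAt_const_div_pow _ _ hz
  smooth_δ₁ z hz := contDiffAt_const_div_pow _ _ hz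
  smooth_δ₂ z hz := contDiffAt_const_div_pow _ _ hz

/-- `red28b2` is linear if `c₂ = 0`. -/
noncomputable def red28b2LinearForm : (red28b2 0).LinearForm where
  Z := {z | z ≠ 0}
  isOpen_Z := isOpen_ne
  g z := -z ^ 2
  γ z := 1 / z ^ 1
  δ₀ _ := 0
  δ₁ _ := 0
  mem_dom z w := by simp [red28b2]
  g_ne z hz := neg_ne_zero.2 (pow_ne_zero 2 hz)
  lhs_eq z hz w w₁ w₂ := by
    have hz : z ≠ 0 := hz
    simp only [red28b2]
    field_simp
    ring
  smooth_γ z hz := contDiffAt_const_div_pow _ _ hz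
  smooth_δ₀ z _ := contDiffAt_const
  smooth_δ₁ z _ := contDiffAt_const

theorem red28b2_linearizableIff (c₂ : ℝ) : (red28b2 c₂).LinearizableIff (c₂ = 0) := by
  by_cases hc : c₂ = 0
  · subst hc
    exact red28b2LinearForm.linearizableIff rfl
  refine (red28b2Form c₂ hc).linearizableIff (fun V hV hne hVE h => ?_) fun h => absurd h hc
  obtain ⟨z, hz, hev⟩ :=
    (red28b2Form c₂ hc).eventually_of_psi₁ hV hne hVE fun z w h' => (h z w h').1
  have hz : z ≠ 0 := hz
  have h1 := hev.self_of_nhds.2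
  -- Here `φ` is constant, while `γ₀ = -7 / (c₂² z)` has no zero.
  simp [red28b2Form, hz, hc] at h1

/-- The normal form of `red212b1` if `c₃ ≠ 0`. -/
noncomputable def red212b1Form (c₃ : ℝ) (hc : c₃ ≠ 0) : (red212b1 c₃).QuadraticForm where
  Z := {z | z ≠ 0}
  isOpen_Z := isOpen_ne
  g z := c₃ * z ^ 2
  φ z := 2 / c₃ / z ^ 1
  φ₁ z := -2 / c₃ / z ^ 2
  φ₂ z := 4 / c₃ / z ^ 3
  γ₀ _ := 0
  γ₀' _ := 0
  γ₁ z := 2 / z ^ 1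
  δ₀ _ := 0
  δ₁ _ := 0
  δ₂ _ := 0
  mem_dom z w := by
    by_cases hz : z = 0
    · simp [red212b1, hz]
    · rw [Set.mem_ofPred_eq, and_iff_right hz,
        show w + 2 / c₃ / z ^ 1 = z * (2 + c₃ * w * z) / (c₃ * z ^ 2) by field_simp; ring]
      simp [red212b1, hz, hc]
  g_ne z hz := mul_ne_zero hc (pow_ne_zero 2 hz)
  lhs_eq z hz w w₁ w₂ := by
    have hz : z ≠ 0 := hz
    simp only [red212b1]
    field_simp
    ring
  hasDerivAt_φ z hz := (hasDerivAt_const_div_pow _ 1 hz).congr_deriv (by push_cast; ring)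
  hasDerivAt_φ₁ z hz := (hasDerivAt_const_div_pow _ 2 hz).congr_deriv (by push_cast; ring)
  hasDerivAt_γ₀ z _ := hasDerivAt_const _ _
  smooth_φ z hz := contDiffAt_const_div_pow _ _ hz
  smooth_φ₁ z hz := contDiffAt_const_div_pow _ _ hz
  smooth_γ₀ z _ := contDiffAt_const
  smooth_γ₁ z hz := contDiffAt_const_div_pow _ _ hz
  smooth_δ₀ z _ := contDiffAt_const
  smooth_δ₁ z _ := contDiffAt_const
  smooth_δ₂ z _ := contDiffAt_const

/-- `red212b1` is linear if `c₃ = 0`. -/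
noncomputable def red212b1LinearForm : (red212b1 0).LinearForm where
  Z := {z | z ≠ 0}
  isOpen_Z := isOpen_ne
  g z := 2 * z
  γ z := 2 / z ^ 1
  δ₀ _ := 0
  δ₁ _ := 0
  mem_dom z w := by simp [red212b1]
  g_ne z hz := mul_ne_zero two_ne_zero hz
  lhs_eq z hz w w₁ w₂ := by
    have hz : z ≠ 0 := hz
    simp only [red212b1]
    field_simp
    ring
  smooth_γ z hz := contDiffAt_const_div_pow _ _ hz
  smooth_δ₀ z _ := contDiffAt_const
  smooth_δ₁ z _ := contDiffAt_const

theorem red212b1_linearizableIff (c₃ : ℝ) : (red212b1 c₃).LinearizableIff (c₃ = 0) := by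
  by_cases hc : c₃ = 0
  · subst hc
    exact red212b1LinearForm.linearizableIff rfl
  refine (red212b1Form c₃ hc).linearizableIff (fun V hV hne hVE h => ?_) fun h => absurd h hc
  obtain ⟨z, hz, hev⟩ :=
    (red212b1Form c₃ hc).eventually_of_psi₁ hV hne hVE fun z w h' => (h z w h').1
  have hz : z ≠ 0 := hz
  have h1 := hev.self_of_nhds.2
  -- Here `γ₀ = 0`, while `φ' = -2 / (c₃ z²)` has no zero.
  simp [red212b1Form, hz, hc] at h1

/-- The normal form of `red212b2`. -/
noncomputable def red212b2Form : red212b2.QuadraticForm where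
  Z := Set.univ
  isOpen_Z := isOpen_univ
  g _ := 1
  φ _ := 0
  φ₁ _ := 0
  φ₂ _ := 0
  γ₀ _ := 2
  γ₀' _ := 0
  γ₁ _ := 0
  δ₀ _ := 0
  δ₁ _ := 0
  δ₂ _ := 0
  mem_dom z w := by simp [red212b2]
  g_ne z _ := one_ne_zero
  lhs_eq z _ w w₁ w₂ := by
    simp only [red212b2]
    ring
  hasDerivAt_φ z _ := hasDerivAt_const _ _
  hasDerivAt_φ₁ z _ := hasDerivAt_const _ _
  hasDerivAt_γ₀ z _ := hasDerivAt_const _ _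
  smooth_φ z _ := contDiffAt_const
  smooth_φ₁ z _ := contDiffAt_const
  smooth_γ₀ z _ := contDiffAt_const
  smooth_γ₁ z _ := contDiffAt_const
  smooth_δ₀ z _ := contDiffAt_const
  smooth_δ₁ z _ := contDiffAt_const
  smooth_δ₂ z _ := contDiffAt_const

theorem red212b2_linearizableIff : red212b2.LinearizableIff False :=
  red212b2Form.linearizableIff (fun V hV hne hVE h => by
    obtain ⟨z, -, hev⟩ := red212b2Form.eventually_of_psi₁ hV hne hVE fun z w h' => (h z w h').1
    have h1 := hev.self_of_nhds.2
    simp [red212b2Form] at h1) False.elim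

end SecondOrderODE

/-! ### The equations with real powers of `z`. -/

namespace SecondOrderODE

/-- The normal form of `red28a`. -/
noncomputable def red28aForm (k₀ : ℝ) (h₁ : 1 + 6 * k₀ ≠ 0) (h₂ : 2 + 3 * k₀ ≠ 0) :
    (red28a k₀).QuadraticForm where
  Z := {z | 0 < z}
  isOpen_Z := isOpen_lt continuous_const continuous_id
  g z := -(1 + 6 * k₀) ^ 2 * z ^ (r28 k₀ + 2)
  -- Since `s (2 + 3k₀) = 1 + 6k₀`, the coefficient of `w''` is `g (w + z^(2 - r))`. The factor `1`
  -- fits the shape of `hasDerivAt_const_mul_rpow`.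
  φ z := 1 * z ^ (2 - r28 k₀)
  φ₁ z := (2 - r28 k₀) * z ^ (1 - r28 k₀)
  φ₂ z := (2 - r28 k₀) * (1 - r28 k₀) * z ^ (-r28 k₀)
  -- The fraction comes from `s (1 + s) (2 + 3k₀)² = (1 + 6k₀) (9k₀ + 3)`, and `-4r` from writing `w
  -- = W - φ` in the term `4 r w w' / z`.
  γ₀ z := ((9 * k₀ + 3) / (1 + 6 * k₀) - 4 * r28 k₀) * z ^ (1 - r28 k₀)
  γ₀' z := ((9 * k₀ + 3) / (1 + 6 * k₀) - 4 * r28 k₀) * (1 - r28 k₀) * z ^ (-r28 k₀)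
  γ₁ z := 4 * r28 k₀ / z ^ 1
  δ₀ z := r28 k₀ * (2 * r28 k₀ - 1) * z ^ (2 - 2 * r28 k₀)
  δ₁ z := -2 * r28 k₀ * (2 * r28 k₀ - 1) * z ^ (-r28 k₀)
  δ₂ z := r28 k₀ * (2 * r28 k₀ - 1) / z ^ 2
  mem_dom z w := by
    refine and_congr_right fun (hz : 0 < z) => ?_
    have hR : 0 < z ^ r28 k₀ := Real.rpow_pos_of_pos hz _
    rw [Real.rpow_sub hz, Real.rpow_add hz, Real.rpow_two, s28]
    rw [← mul_ne_zero_iff_left (mul_ne_zero (pow_ne_zero 2 h₁)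
      (mul_ne_zero (pow_ne_zero 2 hz.ne') hR.ne')) (b := w + _), ← neg_ne_zero]
    refine Iff.of_eq (congrArg (· ≠ 0) ?_)
    have h₁' : 1 + k₀ * 6 ≠ 0 := by rwa [mul_comm]
    have h₂' : 2 + k₀ * 3 ≠ 0 := by rwa [mul_comm]
    rw [add_comm (3 * k₀), add_comm (6 * k₀)]
    field_simp
    ring
  g_ne z hz := mul_ne_zero (neg_ne_zero.2 (pow_ne_zero 2 h₁)) (Real.rpow_pos_of_pos hz _).ne'
  lhs_eq z hz w w₁ w₂ := by
    have hz : 0 < z := hz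
    have hR : 0 < z ^ r28 k₀ := Real.rpow_pos_of_pos hz _
    simp only [red28a]
    rw [Real.rpow_sub hz, Real.rpow_add hz, Real.rpow_add hz, Real.rpow_sub hz, Real.rpow_sub hz,
      Real.rpow_neg hz.le, Real.rpow_two, Real.rpow_one, mul_comm 2 (r28 k₀), Real.rpow_mul hz.le,
      Real.rpow_two, s28, add_comm (3 * k₀), add_comm (6 * k₀)]
    have h₁' : 1 + k₀ * 6 ≠ 0 := by rwa [mul_comm]
    have h₂' : 2 + k₀ * 3 ≠ 0 := by rwa [mul_comm]
    generalize r28 k₀ = r at *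
    field_simp
    ring
  hasDerivAt_φ z hz := (hasDerivAt_const_mul_rpow _ (q := 1 - r28 k₀) (by ring) hz).congr_deriv
    (by rw [one_mul])
  hasDerivAt_φ₁ z hz := hasDerivAt_const_mul_rpow _ (by ring) hz
  hasDerivAt_γ₀ z hz := hasDerivAt_const_mul_rpow _ (by ring) hz
  smooth_φ z hz := contDiffAt_const_mul_rpow _ _ hz
  smooth_φ₁ z hz := contDiffAt_const_mul_rpow _ _ hz
  smooth_γ₀ z hz := contDiffAt_const_mul_rpow _ _ hz
  smooth_γ₁ z hz := contDiffAt_const_div_pow _ _ (ne_of_gt hz)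
  smooth_δ₀ z hz := contDiffAt_const_mul_rpow _ _ hz
  smooth_δ₁ z hz := contDiffAt_const_mul_rpow _ _ hz
  smooth_δ₂ z hz := contDiffAt_const_div_pow _ _ (ne_of_gt hz)

theorem r28_one_ninth : r28 (1 / 9) = -4 / 5 := by
  norm_num [r28]

/-- Both sides are multiples of `z^(1 - r)`, so only constants are compared; cleared of
denominators, they give `9k₀ + 3 = 36k₀`. -/
theorem red28a_γ₀_eq_iff {k₀ : ℝ} (h₁ : 1 + 6 * k₀ ≠ 0) (h₂ : 2 + 3 * k₀ ≠ 0) {z : ℝ}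
    (hz : 0 < z) : (red28aForm k₀ h₁ h₂).γ₀ z = 2 * (red28aForm k₀ h₁ h₂).φ₁ z ↔ k₀ = 1 / 9 := by
  have hR : z ^ (1 - r28 k₀) ≠ 0 := (Real.rpow_pos_of_pos hz _).ne'
  simp only [red28aForm]
  have h₁' : 1 + k₀ * 6 ≠ 0 := by rwa [mul_comm]
  rw [← mul_assoc, mul_left_inj' hR, r28, add_comm (6 * k₀)]
  field_simp
  constructor <;> intro h <;> linarith

theorem red28a_psi₁_iff {k₀ : ℝ} (h₁ : 1 + 6 * k₀ ≠ 0) (h₂ : 2 + 3 * k₀ ≠ 0)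
    {V : Set (ℝ × ℝ)} (hV : IsOpen V) (hne : V.Nonempty) (hVE : V ⊆ (red28a k₀).dom) :
    (∀ z w, (z, w) ∈ V → (red28aForm k₀ h₁ h₂).cubic.Psi₁ z w = 0) ↔ k₀ = 1 / 9 := by
  constructor
  · intro h
    obtain ⟨z, hz, hev⟩ := (red28aForm k₀ h₁ h₂).eventually_of_psi₁ hV hne hVE h
    exact (red28a_γ₀_eq_iff h₁ h₂ hz).1 hev.self_of_nhds.2
  · intro hk z w h
    rw [((red28aForm k₀ h₁ h₂).psi (hVE h)).1, (red28a_γ₀_eq_iff h₁ h₂ (hVE h).1).2 hk]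
    simp

theorem red28a_psi₂ {k₀ : ℝ} (h₁ : 1 + 6 * k₀ ≠ 0) (h₂ : 2 + 3 * k₀ ≠ 0) (hk : k₀ = 1 / 9)
    {z w : ℝ} (h : (z, w) ∈ (red28a k₀).dom) : (red28aForm k₀ h₁ h₂).cubic.Psi₂ z w
      = 18 * z ^ (4 / 5 : ℝ) / (25 * (w + z ^ (14 / 5 : ℝ)) ^ 2) := by
  have hz : 0 < z := h.1
  have hW := (((red28aForm k₀ h₁ h₂).mem_dom z w).1 h).2
  rw [((red28aForm k₀ h₁ h₂).psi h).2, (red28a_γ₀_eq_iff h₁ h₂ hz).2 hk]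
  subst hk
  simp only [red28aForm, r28_one_ninth] at hW ⊢
  rw [show (2 : ℝ) - -4 / 5 = 14 / 5 by norm_num, one_mul] at hW ⊢
  rw [show (1 : ℝ) - -4 / 5 = 4 / 5 + 1 by norm_num, show -(-4 / 5 : ℝ) = 4 / 5 by norm_num,
    Real.rpow_add hz, Real.rpow_one]
  field_simp
  norm_num
  ring

/-- The only value of `k₀` for which the first invariant vanishes makes the second one strictly
positive. -/
theorem red28a_linearizableIff {k₀ : ℝ} (h₁ : 1 + 6 * k₀ ≠ 0) (h₂ : 2 + 3 * k₀ ≠ 0) :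
    (red28a k₀).LinearizableIff False := by
  refine (red28aForm k₀ h₁ h₂).linearizableIff (fun V hV hne hVE h => ?_) False.elim
  have hk := (red28a_psi₁_iff h₁ h₂ hV hne hVE).1 fun z w h' => (h z w h').1
  obtain ⟨⟨z, w⟩, hzw⟩ := hne
  have h3 := (h z w hzw).2
  have hz : 0 < z := (hVE hzw).1
  have hW := (((red28aForm k₀ h₁ h₂).mem_dom z w).1 (hVE hzw)).2
  rw [red28a_psi₂ h₁ h₂ hk (hVE hzw)] at h3
  subst hk
  simp only [red28aForm, r28_one_ninth] at hW
  rw [show (2 : ℝ) - -4 / 5 = 14 / 5 by norm_num, one_mul] at hW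
  have := Real.rpow_pos_of_pos hz (4 / 5)
  refine absurd h3 (div_ne_zero (by positivity) (by positivity))

/-- The normal form of `red212a`. -/
noncomputable def red212aForm (s k₀ : ℝ) (hs : s ≠ 0) : (red212a s k₀).QuadraticForm where
  Z := {z | 0 < z}
  isOpen_Z := isOpen_lt continuous_const continuous_id
  g z := -s * z ^ (2 + r212 k₀)
  φ z := -(3 * (k₀ - 1) / s) * z ^ (-1 - r212 k₀)
  φ₁ z := -(3 * (k₀ - 1) / s) * (-1 - r212 k₀) * z ^ (-2 - r212 k₀)
  φ₂ z := -(3 * (k₀ - 1) / s) * (-1 - r212 k₀) * (-2 - r212 k₀) * z ^ (-3 - r212 k₀)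
  γ₀ z := 3 * (k₀ - 1) / s * ((1 + s) / s - (1 + r212 k₀)) * z ^ (-2 - r212 k₀)
  γ₀' z := 3 * (k₀ - 1) / s * ((1 + s) / s - (1 + r212 k₀)) * (-2 - r212 k₀)
    * z ^ (-3 - r212 k₀)
  γ₁ z := (1 + s) / s / z ^ 1
  δ₀ _ := 0
  δ₁ _ := 0
  δ₂ _ := 0
  mem_dom z w := by
    refine and_congr_right fun (hz : 0 < z) => ?_
    have hR : 0 < z ^ r212 k₀ := Real.rpow_pos_of_pos hz _
    rw [Real.rpow_sub hz, Real.rpow_add hz, Real.rpow_two, Real.rpow_neg_one]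
    rw [← mul_ne_zero_iff_left (mul_ne_zero hs
      (mul_ne_zero (pow_ne_zero 2 hz.ne') hR.ne')) (b := w + _), ← neg_ne_zero]
    refine Iff.of_eq (congrArg (· ≠ 0) ?_)
    field_simp
    ring
  g_ne z hz := mul_ne_zero (neg_ne_zero.2 hs) (Real.rpow_pos_of_pos hz _).ne'
  lhs_eq z hz w w₁ w₂ := by
    have hz : 0 < z := hz
    have hR : 0 < z ^ r212 k₀ := Real.rpow_pos_of_pos hz _
    simp only [red212a]
    rw [Real.rpow_sub hz, Real.rpow_sub hz, Real.rpow_add hz, Real.rpow_add hz, Real.rpow_neg hz.le,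
      Real.rpow_neg hz.le, Real.rpow_two, Real.rpow_one]
    generalize r212 k₀ = r at *
    field_simp
    ring
  hasDerivAt_φ z hz := hasDerivAt_const_mul_rpow _ (by ring) hz
  hasDerivAt_φ₁ z hz := hasDerivAt_const_mul_rpow _ (by ring) hz
  hasDerivAt_γ₀ z hz := hasDerivAt_const_mul_rpow _ (by ring) hz
  smooth_φ z hz := contDiffAt_const_mul_rpow _ _ hz
  smooth_φ₁ z hz := contDiffAt_const_mul_rpow _ _ hz
  smooth_γ₀ z hz := contDiffAt_const_mul_rpow _ _ hz
  smooth_γ₁ z hz := contDiffAt_const_div_pow _ _ (ne_of_gt hz)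
  smooth_δ₀ z _ := contDiffAt_const
  smooth_δ₁ z _ := contDiffAt_const
  smooth_δ₂ z _ := contDiffAt_const

theorem red212a_γ₀_eq_iff {s k₀ : ℝ} (hs : s ≠ 0) (hk : k₀ ≠ 1) {z : ℝ} (hz : 0 < z) :
    (red212aForm s k₀ hs).γ₀ z = 2 * (red212aForm s k₀ hs).φ₁ z ↔ 1 / s = 2 + 3 * r212 k₀ := by
  have hR : z ^ (-2 - r212 k₀) ≠ 0 := (Real.rpow_pos_of_pos hz _).ne'
  have hk' : k₀ - 1 ≠ 0 := sub_ne_zero.2 hk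
  simp only [red212aForm]
  rw [← mul_assoc, mul_left_inj' hR]
  field_simp
  constructor <;> intro h <;> linarith

theorem red212a_γ₀_eq_half_iff {s k₀ : ℝ} (hs : s ≠ 0) (hk : k₀ ≠ 1) {z : ℝ} (hz : 0 < z) :
    2 * (red212aForm s k₀ hs).γ₀ z = (red212aForm s k₀ hs).φ₁ z ↔ 2 / s = 1 + 3 * r212 k₀ := by
  have hR : z ^ (-2 - r212 k₀) ≠ 0 := (Real.rpow_pos_of_pos hz _).ne'
  have hk' : k₀ - 1 ≠ 0 := sub_ne_zero.2 hk
  simp only [red212aForm]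
  rw [← mul_assoc, mul_left_inj' hR]
  field_simp
  constructor <;> intro h <;> linarith

/-- The coefficient of `1 / W ^ 2` in the second invariant. -/
theorem red212a_bracket {s k₀ : ℝ} (hs : s ≠ 0) {z : ℝ} (hz : 0 < z) :
    2 * (red212aForm s k₀ hs).γ₀' z - (red212aForm s k₀ hs).φ₂ z - 3 * (red212aForm s k₀ hs).δ₁ z
      + 2 * (red212aForm s k₀ hs).γ₀ z * (red212aForm s k₀ hs).γ₁ z
      - (red212aForm s k₀ hs).γ₁ z * (red212aForm s k₀ hs).φ₁ z
      = (2 * (red212aForm s k₀ hs).γ₀ z - (red212aForm s k₀ hs).φ₁ z)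
        * ((1 / s - 1 - r212 k₀) / z) := by
  simp only [red212aForm]
  rw [show -2 - r212 k₀ = -3 - r212 k₀ + 1 by ring, Real.rpow_add hz, Real.rpow_one]
  field_simp
  ring

theorem red212a_psi₁_iff {s k₀ : ℝ} (hs : s ≠ 0) (hk : k₀ ≠ 1)
    {V : Set (ℝ × ℝ)} (hV : IsOpen V) (hne : V.Nonempty) (hVE : V ⊆ (red212a s k₀).dom) :
    (∀ z w, (z, w) ∈ V → (red212aForm s k₀ hs).cubic.Psi₁ z w = 0) ↔
      1 / s = 2 + 3 * r212 k₀ := by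
  constructor
  · intro h
    obtain ⟨z, hz, hev⟩ := (red212aForm s k₀ hs).eventually_of_psi₁ hV hne hVE h
    exact (red212a_γ₀_eq_iff hs hk hz).1 hev.self_of_nhds.2
  · intro h' z w h
    rw [((red212aForm s k₀ hs).psi (hVE h)).1, (red212a_γ₀_eq_iff hs hk (hVE h).1).2 h']
    simp

/-- By `red212a_bracket`, `2γ₀ - φ'` is a factor of the whole second invariant. The other factor is
a combination of `1 / W²` and `1 / W³` whose coefficients must vanish separately. -/
theorem red212a_psi₂_iff {s k₀ : ℝ} (hs : s ≠ 0) (hk : k₀ ≠ 1)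
    {V : Set (ℝ × ℝ)} (hV : IsOpen V) (hne : V.Nonempty) (hVE : V ⊆ (red212a s k₀).dom) :
    (∀ z w, (z, w) ∈ V → (red212aForm s k₀ hs).cubic.Psi₂ z w = 0) ↔
      (2 / s = 1 + 3 * r212 k₀ ∨ (1 / s = 1 + r212 k₀ ∧ 1 / s = 2 + 3 * r212 k₀)) := by
  constructor
  · intro h
    obtain ⟨z, hz, e₁, e₂⟩ := (red212aForm s k₀ hs).eq_of_psi₂ hV hne hVE h
    have hz : 0 < z := hz
    rw [red212a_bracket hs hz, mul_eq_zero, sub_eq_zero, red212a_γ₀_eq_half_iff hs hk hz,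
      div_eq_zero_iff, or_iff_left hz.ne'] at e₁
    rw [mul_eq_zero, sub_eq_zero, sub_eq_zero, red212a_γ₀_eq_half_iff hs hk hz,
      red212a_γ₀_eq_iff hs hk hz] at e₂
    rcases e₁ with e₁ | e₁
    · exact Or.inl e₁
    · exact e₂.imp_right fun e₂ => ⟨by linarith, e₂⟩
  · intro h' z w h
    have hz : 0 < z := (hVE h).1
    rw [((red212aForm s k₀ hs).psi (hVE h)).2, red212a_bracket hs hz]
    rcases h' with h' | ⟨h', h''⟩
    · rw [(red212a_γ₀_eq_half_iff hs hk hz).2 h']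
      simp
    · rw [(red212a_γ₀_eq_iff hs hk hz).2 h'', h']
      simp

theorem red212a_linearizableIff {s k₀ : ℝ} (hs : s ≠ 0) (hk : k₀ ≠ 1) (hk' : k₀ ≠ -1 / 3)
    {P : Prop} (hP : P ↔ 1 / s = 2 + 3 * r212 k₀ ∧ 1 / s = 1 + r212 k₀) :
    (red212a s k₀).LinearizableIff P := by
  refine (red212aForm s k₀ hs).linearizableIff (fun V hV hne hVE h => hP.2 ?_) fun h z hz => ?_
  · have e₁ := (red212a_psi₁_iff hs hk hV hne hVE).1 fun z w h' => (h z w h').1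
    refine ⟨e₁, ?_⟩
    rcases (red212a_psi₂_iff hs hk hV hne hVE).1 fun z w h' => (h z w h').2 with e₂ | e₂
    -- If the common factor `2γ₀ - φ'` vanished together with `γ₀ - 2φ'`, then `r = -1`, which is
    -- the excluded value `k₀ = -1/3`.
    · have hr : r212 k₀ = -1 := by linear_combination (e₂ - 2 * e₁) / 3
      rw [r212, div_eq_iff (mul_ne_zero three_ne_zero (sub_ne_zero.2 hk.symm))] at hr
      exact absurd (by linarith) hk'
    · exact e₂.1
  · obtain ⟨e₁, e₂⟩ := hP.1 h
    have hz : 0 < z := hz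
    refine ⟨(red212a_γ₀_eq_iff hs hk hz).2 e₁, ?_⟩
    have e₃ : (1 + s) / s = 2 + r212 k₀ := by
      rw [add_div, div_self hs]
      linear_combination e₂
    simp only [red212aForm, e₃]
    rw [show -2 - r212 k₀ = -3 - r212 k₀ + 1 by ring, Real.rpow_add hz, Real.rpow_one]
    field_simp
    ring

theorem s212_ne_zero {k₀ : ℝ} (hk : k₀ ≠ 1) (hk' : k₀ ≠ -1 / 3) : s212 k₀ ≠ 0 :=
  div_ne_zero (mul_ne_zero three_ne_zero (sub_ne_zero.2 hk))
    fun h => hk' (by linarith)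

theorem one_div_s212_eq_iff {k₀ : ℝ} (hk : k₀ ≠ 1) :
    1 / s212 k₀ = 2 + 3 * r212 k₀ ↔ k₀ = -1 / 15 := by
  have h₁ : 1 - k₀ ≠ 0 := sub_ne_zero.2 hk.symm
  rw [s212, r212, one_div_div, ← neg_sub 1 k₀]
  field_simp
  constructor <;> intro h <;> linarith

/-- In fact `1 + r = -1 / s`, so equality would make `1 / s`, hence `1 + 3k₀`, zero. -/
theorem one_div_s212_ne {k₀ : ℝ} (hk : k₀ ≠ 1) (hk' : k₀ ≠ -1 / 3) :
    1 / s212 k₀ ≠ 1 + r212 k₀ := by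
  have h₁ : 1 - k₀ ≠ 0 := sub_ne_zero.2 hk.symm
  rw [s212, r212, one_div_div, ← neg_sub 1 k₀]
  field_simp
  intro h
  rw [← neg_div, div_left_inj' (mul_ne_zero three_ne_zero h₁)] at h
  exact hk' (by linarith)

theorem two_div_s212_eq_iff {k₀ : ℝ} (hk : k₀ ≠ 1) :
    2 / s212 k₀ = 1 + 3 * r212 k₀ ↔ k₀ = 1 / 21 := by
  have h₁ : 1 - k₀ ≠ 0 := sub_ne_zero.2 hk.symm
  rw [s212, r212, div_div_eq_mul_div, ← neg_sub 1 k₀]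
  field_simp
  constructor <;> intro h <;> linarith

/-- After the change of sign of `s`, the relation `1 / s = 1 + r` is an identity, so only the first
condition restricts `k₀`; it becomes `r = -1/2`. -/
theorem one_div_neg_s212_eq_iff {k₀ : ℝ} (hk : k₀ ≠ 1) :
    k₀ = 1 / 9 ↔ 1 / -s212 k₀ = 2 + 3 * r212 k₀ ∧ 1 / -s212 k₀ = 1 + r212 k₀ := by
  have h₁ : 1 - k₀ ≠ 0 := sub_ne_zero.2 hk.symm
  rw [one_div_neg_eq_neg_one_div, s212, r212, one_div_div, ← neg_sub 1 k₀]
  field_simp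
  constructor
  · intro h
    exact ⟨by linarith, by linarith⟩
  · rintro ⟨h, -⟩
    linarith

end SecondOrderODE

/-! ### Assembly of the results for all equations. -/

open SecondOrderODE

theorem mainTheorem2 :
    -- reduction by `{v₀, k₀ v₀ + z(1)}`
    (red21.LinearizableIff False ∧
      ∃ N : CubicForm, red21.HasCubicForm N ∧ ∀ z w : ℝ, (z, w) ∈ red21.dom →
        N.Psi₁ z w = 54 * z / (4 + w * z) ^ 3 ∧
        N.Psi₂ z w = -(72 * (-2 + w * z) / (z * (4 + w * z) ^ 3))) ∧
    -- the second reduction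
    (∀ l k₀ k₁ c₁ c₂ c₃ : ℝ,
      (red22 l k₀ k₁ c₁ c₂ c₃).LinearizableIff (c₂ = 0 ∨ (k₀ = 0 ∧ k₁ = 0))) ∧
    -- linearizable only for `k₀ = 0`, where it is linear in `w ^ 2`
    (∀ k₀ : ℝ, (red27 k₀).LinearizableIff (k₀ = 0)) ∧
    (∀ (w : ℝ → ℝ) (z : ℝ), ContDiffAt ℝ 2 w z →
      ((red27 0).lhs z (w z) (deriv w z) (deriv (deriv w) z) = 0 ↔
        deriv (deriv (fun t => w t ^ 2)) z = 0)) ∧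
    -- the general case of the third reduction
    (∀ k₀ : ℝ, k₀ ≠ -1 / 6 → k₀ ≠ -2 / 3 →
      (red28a k₀).LinearizableIff False ∧
      ∃ N : CubicForm, (red28a k₀).HasCubicForm N ∧
        (∀ V : Set (ℝ × ℝ), IsOpen V → V.Nonempty → V ⊆ (red28a k₀).dom →
          ((∀ z w, (z, w) ∈ V → N.Psi₁ z w = 0) ↔ k₀ = 1 / 9)) ∧
        (k₀ = 1 / 9 → ∀ z w : ℝ, (z, w) ∈ (red28a k₀).dom →
          N.Psi₂ z w = 18 * z ^ (4 / 5 : ℝ) / (25 * (w + z ^ (14 / 5 : ℝ)) ^ 2))) ∧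
    -- its special cases
    (∀ c₁ : ℝ, (red28b1 c₁).LinearizableIff (c₁ = 0)) ∧
    (∀ c₂ : ℝ, (red28b2 c₂).LinearizableIff (c₂ = 0)) ∧
    -- the general case of the last reduction
    (∀ k₀ : ℝ, k₀ ≠ 1 → k₀ ≠ -1 / 3 →
      (red212a (s212 k₀) k₀).LinearizableIff False ∧
      ∃ N : CubicForm, (red212a (s212 k₀) k₀).HasCubicForm N ∧
        ∀ V : Set (ℝ × ℝ), IsOpen V → V.Nonempty → V ⊆ (red212a (s212 k₀) k₀).dom →
          ((∀ z w, (z, w) ∈ V → N.Psi₁ z w = 0) ↔ k₀ = -1 / 15) ∧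
          ((∀ z w, (z, w) ∈ V → N.Psi₂ z w = 0) ↔ k₀ = 1 / 21)) ∧
    (∀ k₀ : ℝ, k₀ ≠ 1 → k₀ ≠ -1 / 3 →
      (red212a (-s212 k₀) k₀).LinearizableIff (k₀ = 1 / 9)) ∧
    -- its special cases; the value `c₃ = 0` is excluded in the reduction
    (∀ c₃ : ℝ, (red212b1 c₃).LinearizableIff (c₃ = 0)) ∧
    (∀ c₃ : ℝ, c₃ ≠ 0 → ∀ p ∈ (red212b1 c₃).dom, ¬ (red212b1 c₃).LinearizableAt p) ∧
    red212b2.LinearizableIff False := by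
  refine ⟨⟨red21_linearizableIff, red21Form.cubic, red21Form.hasCubicForm,
    fun z w h => red21_psi h⟩, red22_linearizableIff, red27_linearizableIff,
    fun w z hw => red27_zero_lhs hw, fun k₀ h₁ h₂ => ?_, red28b1_linearizableIff,
    red28b2_linearizableIff, fun k₀ h₁ h₂ => ?_, fun k₀ h₁ h₂ => ?_, red212b1_linearizableIff,
    fun c₃ hc p hp h => hc (((red212b1_linearizableIff c₃).2 p hp).1 h), red212b2_linearizableIff⟩
  · have h₁ : 1 + 6 * k₀ ≠ 0 := fun h => h₁ (by linarith)
    have h₂ : 2 + 3 * k₀ ≠ 0 := fun h => h₂ (by linarith)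
    exact ⟨red28a_linearizableIff h₁ h₂, (red28aForm k₀ h₁ h₂).cubic,
      (red28aForm k₀ h₁ h₂).hasCubicForm, fun V hV hne hVE => red28a_psi₁_iff h₁ h₂ hV hne hVE,
      fun hk z w h => red28a_psi₂ h₁ h₂ hk h⟩
  · have hs := s212_ne_zero h₁ h₂
    have hne := one_div_s212_ne h₁ h₂
    refine ⟨red212a_linearizableIff hs h₁ h₂ (by simp only [hne, and_false]),
      (red212aForm _ k₀ hs).cubic, (red212aForm _ k₀ hs).hasCubicForm,
      fun V hV hV' hVE => ⟨?_, ?_⟩⟩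
    · rw [red212a_psi₁_iff hs h₁ hV hV' hVE, one_div_s212_eq_iff h₁]
    · rw [red212a_psi₂_iff hs h₁ hV hV' hVE, two_div_s212_eq_iff h₁]
      simp only [hne, false_and, or_false]
  · exact red212a_linearizableIff (neg_ne_zero.2 (s212_ne_zero h₁ h₂)) h₁ h₂
      (one_div_neg_s212_eq_iff h₁)
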